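/- **Continuous data.** Let $d\in\{2,3\}$ and let $\Omega\subset\mathbb R^d$ be a bounded connected polyhedral open set. Let $\eta:\mathbb R\to\mathbb R$ be continuous and even, with $\eta(0)=0$, $\eta>0$ on $\mathbb R\setminus\{0\}$, and non-decreasing on $[0,\infty)$. Let $p\in L^1_{\rm loc}([0,\infty))$ be absolutely continuous on compact subintervals of $(0,\infty)$ and increasing there, with $p'>0$ a.e., $p(u)\to+\infty$ as $u\to+\infty$, $\sqrt\eta\,p'\in L^1_{\rm loc}([0,\infty))$ and $\sqrt{\eta(u)}\,p(u)\to0$ as $u\searrow0$. Put $p(0)=\lim_{u\searrow0}p(u)\in[-\infty,\infty)$. If $p(0)>-\infty$, extend $p$ by $p(u)=2p(0)-p(-u)$ for $u\le 0$ and set $I_p=\mathbb R$; if $p(0)=-\infty$ set $I_p=(0,\infty)$. Let $\Gamma(u)=\int_1^u(p(a)-p(1))\,da$ for $u\in\overline{I_p}$ and $\Gamma(u)=+\infty$ otherwise, and $\xi(u)=\int_0^u\sqrt{\eta(a)}\,p'(a)\,da$ for $u\ge0$. Assume that $0\le\xi\le C(1+\Gamma)$ on $[0,\infty)$ for some $C>0$,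 that $\Gamma(u)/\eta(u)\to+\infty$ as $u\to+\infty$, and that $\sqrt{\eta\circ\xi^{-1}}$ is uniformly continuous on the range of $\xi$. Let $\Lambda\in L^\infty(\Omega)^{d\times d}$ be symmetric a.e. with $\lambda_\star|v|^2\le\Lambda(x)v\cdot v\le\lambda^\star|v|^2$ for all $v\in\mathbb R^d$ and a.e. $x\in\Omega$, where $0<\lambda_\star\le\lambda^\star<\infty$. Let $V$ be Lipschitz continuous on $\overline\Omega$. **Mesh.** Let $\mathcal M$ be a finite set of pairwise disjoint open cells $\kappa\subset\Omega$ with $\bigcup_\kappa\overline\kappa=\overline\Omega$, each star-shaped with respect to a center $x_\kappa\in\kappa$, whose boundary is the union of its faces. Let $\mathcal V$ be the finite set of vertices, located at $x_s\in\overline\Omega$, let $\mathcal V_\kappa$ and $\mathcal V_\sigma$ be the sets of vertices of the cell $\kappa$ and of the face $\sigma$, and let $\mathcal M_s=\{\kappa : s\in\mathcal V_\kappa\}$. If $d=2$ a face is the segment joining its two vertices. If $d=3$ a face $\sigma$ has a center $x_\sigma=\sum_{s\in\mathcal V_\sigma}\beta_{\sigma,s}x_s$ with $\beta_{\sigma,s}\ge0$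 and $\sum_{s\in\mathcal V_\sigma}\beta_{\sigma,s}=1$, and it is the union of the triangles spanned by $x_\sigma$ and the edges of $\sigma$. Joining $x_\kappa$ to the segments (resp. triangles) that make up its faces gives simplices, which are assumed to be nondegenerate and to form a conforming simplicial mesh $\mathcal T$. Let $W_{\mathcal D}=\mathbb R^{\mathcal M\cup\mathcal V}$. For $\mathbf v\in W_{\mathcal D}$ let $\pi_{\mathcal T}\mathbf v$ be the continuous function, affine on each simplex of $\mathcal T$, with value $v_\kappa$ at $x_\kappa$, $v_s$ at $x_s$ and, if $d=3$, $\sum_{s\in\mathcal V_\sigma}\beta_{\sigma,s}v_s$ at $x_\sigma$. **Mass lumping.** Let $\alpha_{\kappa,s}\ge0$ with $\sum_{s\in\mathcal V_\kappa}\alpha_{\kappa,s}\le1$, and set $m_{\kappa,s}=\alpha_{\kappa,s}\,{\rm meas}(\kappa)$, $m_s=\sum_{\kappa\in\mathcal M_s}m_{\kappa,s}$ and $m_\kappa={\rm meas}(\kappa)-\sum_{s\in\mathcal V_\kappa}m_{\kappa,s}$; assume that $m_\beta>0$ for all $\beta\in\mathcal M\cup\mathcal V$. Let $\omega_\kappa,\omega_{\kappa,s}$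 ($s\in\mathcal V_\kappa$) be disjoint open subsets of $\kappa$ of measures $m_\kappa,m_{\kappa,s}$ whose closures cover $\overline\kappa$, let $\omega_s=\bigcup_{\kappa\in\mathcal M_s}\omega_{\kappa,s}$, and let $\pi_{\mathcal D}\mathbf v=\sum_\kappa v_\kappa\mathbf 1_{\omega_\kappa}+\sum_s v_s\mathbf 1_{\omega_s}$. **Scheme.** Let $\mathbf V=(V(x_\kappa),V(x_s))_{\kappa,s}$, $\mathbf h(\mathbf u)=(p(u_\beta)+V_\beta)_{\beta\in\mathcal M\cup\mathcal V}$, $(\delta_\kappa\mathbf v)_s=v_\kappa-v_s$ for $s\in\mathcal V_\kappa$, $\eta_{\kappa,s}(\mathbf u)=\frac12(\eta(u_\kappa)+\eta(u_s))$, and $\mathbb A_\kappa=(a^\kappa_{s,s'})_{s,s'\in\mathcal V_\kappa}$ with $a^\kappa_{s,s'}=\int_\kappa\Lambda\nabla\pi_{\mathcal T}\mathbf e_s\cdot\nabla\pi_{\mathcal T}\mathbf e_{s'}\,dx$, where $\mathbf e_s$ is the canonical basis vector of $W_{\mathcal D}$ attached to $s$. Let $\mathbb M_\kappa(\mathbf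 u)={\rm diag}(\sqrt{\eta_{\kappa,s}(\mathbf u)})_{s\in\mathcal V_\kappa}$ and $\mathbb B_\kappa(\mathbf u)=\mathbb M_\kappa(\mathbf u)\mathbb A_\kappa\mathbb M_\kappa(\mathbf u)$. The discrete entropy is $$\mathcal E_{\mathcal D}(\mathbf v)=\int_\Omega\big(\Gamma(\pi_{\mathcal D}\mathbf v)+\pi_{\mathcal D}\mathbf v\,\pi_{\mathcal D}\mathbf V\big)\,dx\in(-\infty,+\infty].$$ A vector $\mathbf v\in W_{\mathcal D}$ is *admissible* if $v_\beta\in I_p$ for all $\beta\in\mathcal M\cup\mathcal V$. Given $\Delta t_n>0$ and $\mathbf u^{n-1}\in W_{\mathcal D}$, the scheme consists in finding an admissible $\mathbf u^n$ such that $$m_\kappa\frac{u_\kappa^n-u_\kappa^{n-1}}{\Delta t_n}+\sum_{s\in\mathcal V_\kappa}F_{\kappa,s}(\mathbf u^n)=0\quad\forall\kappa\in\mathcal M,\qquad m_s\frac{u_s^n-u_s^{n-1}}{\Delta t_n}+\sum_{\kappa\in\mathcal M_s}F_{s,\kappa}(\mathbf u^n)=0\quad\forall s\in\mathcal V,$$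 where, for $\kappa\in\mathcal M$ and $s\in\mathcal V_\kappa$, $F_{\kappa,s}(\mathbf u)=\sqrt{\eta_{\kappa,s}(\mathbf u)}\sum_{s'\in\mathcal V_\kappa}a^\kappa_{s,s'}\sqrt{\eta_{\kappa,s'}(\mathbf u)}\,\big(h_\kappa(\mathbf u)-h_{s'}(\mathbf u)\big)$ and $F_{s,\kappa}(\mathbf u)=-F_{\kappa,s}(\mathbf u)$. **Theorem.** Let $\mathbf u^{n-1}\in W_{\mathcal D}$ satisfy $\mathcal E_{\mathcal D}(\mathbf u^{n-1})<+\infty$ and, if $p(0)=-\infty$, also $\int_\Omega\pi_{\mathcal D}\mathbf u^{n-1}\,dx>0$. Then the scheme has at least one admissible solution $\mathbf u^n$, and every admissible solution satisfies $$\mathcal E_{\mathcal D}(\mathbf u^n)+\Delta t_n\sum_{\kappa\in\mathcal M}\delta_\kappa\mathbf h(\mathbf u^n)\cdot\mathbb B_\kappa(\mathbf u^n)\,\delta_\kappa\mathbf h(\mathbf u^n)\le\mathcal E_{\mathcal D}(\mathbf u^{n-1}).$$ -/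

import Mathlib

open MeasureTheory Set Filter Topology
open scoped ENNReal NNReal Matrix

namespace VAG

noncomputable section

/-! ### Data of the continuous problem -/

/-- The Euclidean space `ℝ^d`. -/
abbrev Space (d : ℕ) : Type := EuclideanSpace ℝ (Fin d)

/-- `p(0) = -∞`. -/
def PressureSingular (p : ℝ → ℝ) : Prop := Tendsto p (𝓝[>] 0) atBot

/-- The interval `I_p`: `(0,∞)` if `p(0) = -∞`, and the whole line otherwise. -/
def Ip (p : ℝ → ℝ) : Set ℝ := {u | PressureSingular p → 0 < u}

/-- The value `∫_1^u (p(a) - p(1)) da` of the entropy function (meaningful on the closure of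
`I_p`). -/
def entropyReal (p : ℝ → ℝ) (u : ℝ) : ℝ := ∫ a in (1 : ℝ)..u, (p a - p 1)

open Classical in
/-- The entropy function `Γ`, with values in `[0,+∞]`. The integral is nonnegative on the closure
of `I_p` because `p` is increasing; outside of that closure `Γ = +∞`. -/
def Gam (p : ℝ → ℝ) (u : ℝ) : ℝ≥0∞ :=
  if u ∈ closure (Ip p) then ENNReal.ofReal (entropyReal p u) else ⊤

/-- The function `ξ(u) = ∫_0^u √η(a) p'(a) da`, `u ≥ 0`. -/
def xi (η p : ℝ → ℝ) (u : ℝ) : ℝ := ∫ a in (0 : ℝ)..u, √(η a) * deriv p a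

/-- Assumptions on the mobility function, already extended to an even function on `ℝ`. -/
structure IsMobility (η : ℝ → ℝ) : Prop where
  continuous : Continuous η
  zero : η 0 = 0
  pos : ∀ u, u ≠ 0 → 0 < η u
  mono : MonotoneOn η (Ici 0)
  even : ∀ u, η (-u) = η u

/-- Assumptions on the pressure function. If `p(0) = -∞` only the values of `p` on `(0,∞)` matter;
otherwise `p(0)` is the (finite) right limit at `0` and `p` is extended by symmetry to `(-∞,0]`. -/
structure IsPressure (η p : ℝ → ℝ) : Prop where
  locallyIntegrable : LocallyIntegrableOn p (Ici 0)
  absolutelyContinuous : ∀ a b : ℝ, 0 < a → a ≤ b → AbsolutelyContinuousOnInterval p a b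
  strictMono : StrictMonoOn p (Ioi 0)
  deriv_pos : ∀ᵐ u ∂(volume.restrict (Ioi (0 : ℝ))), 0 < deriv p u
  tendsto_atTop : Tendsto p atTop atTop
  extension : PressureSingular p ∨
    (Tendsto p (𝓝[>] 0) (𝓝 (p 0)) ∧ ∀ u ≤ 0, p u = 2 * p 0 - p (-u))
  sqrt_mul_deriv : LocallyIntegrableOn (fun u => √(η u) * deriv p u) (Ici 0)
  sqrt_mul_tendsto : Tendsto (fun u => √(η u) * p u) (𝓝[>] 0) (𝓝 0)

/-- Compatibility assumptions between `ξ`, `η` and `Γ`. -/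
structure IsCompatible (η p : ℝ → ℝ) : Prop where
  xi_bound : ∃ C > 0, ∀ u, 0 ≤ u → 0 ≤ xi η p u ∧ xi η p u ≤ C * (1 + entropyReal p u)
  superlinear : Tendsto (fun u => entropyReal p u / η u) atTop atTop
  unifCont : UniformContinuousOn
    (fun y => √(η (Function.invFunOn (xi η p) (Ici 0) y))) (xi η p '' Ici 0)

/-- Assumptions on the permeability tensor field on `Ω`: measurable, symmetric, bounded and
uniformly elliptic. -/
structure IsPermeability {d : ℕ} (Ω : Set (Space d)) (L : Space d → Space d →L[ℝ] Space d) :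
    Prop where
  measurable : AEStronglyMeasurable L (volume.restrict Ω)
  symm : ∀ᵐ x ∂(volume.restrict Ω), ∀ v w, inner ℝ (L x v) w = inner ℝ v (L x w)
  elliptic : ∃ lmin lmax : ℝ, 0 < lmin ∧ lmin ≤ lmax ∧ ∀ᵐ x ∂(volume.restrict Ω), ∀ v,
    lmin * ‖v‖ ^ 2 ≤ inner ℝ (L x v) v ∧ inner ℝ (L x v) v ≤ lmax * ‖v‖ ^ 2

/-! ### The mesh -/

/-- Combinatorial and geometric data of a mesh with cells `M`, faces `F` and vertices `V`.
For `d = 3`, `faceEdges σ` is the set of the edges of the face `σ`, an edge being given by its pair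
of vertices. For `d = 2`, where a face is a segment, `faceEdges σ` consists of the pair of vertices
of `σ` alone (see `IsMesh.two_dim`). The weights `beta` are only used if `d = 3`. -/
structure MeshData (d : ℕ) (M F V : Type*) where
  cell : M → Set (Space d)
  cellCenter : M → Space d
  vertexPos : V → Space d
  cellFaces : M → Finset F
  faceVerts : F → Finset V
  faceEdges : F → Finset (Finset V)
  beta : F → V → ℝ

/-- The discrete space `W_D`: one value per cell and one per vertex. -/
abbrev W (M V : Type*) : Type _ := M ⊕ V → ℝ

namespace MeshData

variable {d : ℕ} {M F V : Type*} [Fintype M] [Fintype F] [Fintype V]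
  [DecidableEq M] [DecidableEq F] [DecidableEq V]

/-- The vertices of a cell. -/
def cellVerts (D : MeshData d M F V) (κ : M) : Finset V := (D.cellFaces κ).biUnion D.faceVerts

/-- The cells sharing a vertex. -/
def vertexCells (D : MeshData d M F V) (s : V) : Finset M :=
  Finset.univ.filter fun κ => s ∈ D.cellVerts κ

/-- The face center `x_σ = ∑ β_{σ,s} x_s`. -/
def faceCenter (D : MeshData d M F V) (σ : F) : Space d :=
  ∑ s ∈ D.faceVerts σ, D.beta σ s • D.vertexPos s

/-- The interpolation `I_σ(v) = ∑ β_{σ,s} v_s` at the face center. -/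
def faceInterp (D : MeshData d M F V) (v : W M V) (σ : F) : ℝ :=
  ∑ s ∈ D.faceVerts σ, D.beta σ s * v (Sum.inr s)

/-- Position of a node of the simplicial submesh: a cell center, a face center or a vertex. -/
def nodePos (D : MeshData d M F V) : M ⊕ F ⊕ V → Space d
  | Sum.inl κ => D.cellCenter κ
  | Sum.inr (Sum.inl σ) => D.faceCenter σ
  | Sum.inr (Sum.inr s) => D.vertexPos s

/-- Value at a node of the simplicial submesh of the reconstruction of `v`. -/
def nodeVal (D : MeshData d M F V) (v : W M V) : M ⊕ F ⊕ V → ℝ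
  | Sum.inl κ => v (Sum.inl κ)
  | Sum.inr (Sum.inl σ) => D.faceInterp v σ
  | Sum.inr (Sum.inr s) => v (Sum.inr s)

/-- The nodes spanning a piece of a face: for `d = 3` the triangle `T_{σ,e}` with vertices `x_σ` and
the end points of the edge `e`; for `d = 2` the segment between the end points of the face. -/
def pieceNodes (_D : MeshData d M F V) (σ : F) (e : Finset V) : Finset (M ⊕ F ⊕ V) :=
  (if d = 3 then {Sum.inr (Sum.inl σ)} else ∅) ∪ e.image fun s => Sum.inr (Sum.inr s)

/-- The nodes of the simplex `T_{κ,σ,e}` (which is `T_{κ,σ}` for `d = 2`). -/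
def simplexNodes (D : MeshData d M F V) (T : M × F × Finset V) : Finset (M ⊕ F ⊕ V) :=
  insert (Sum.inl T.1) (D.pieceNodes T.2.1 T.2.2)

/-- The closed convex hull of a finite set of nodes. -/
def hull (D : MeshData d M F V) (N : Finset (M ⊕ F ⊕ V)) : Set (Space d) :=
  convexHull ℝ (D.nodePos '' (N : Set (M ⊕ F ⊕ V)))

/-- The face `σ` as a subset of the space. -/
def faceSet (D : MeshData d M F V) (σ : F) : Set (Space d) :=
  ⋃ e ∈ D.faceEdges σ, D.hull (D.pieceNodes σ e)

/-- The (index set of the) simplicial submesh. -/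
def submesh (D : MeshData d M F V) : Set (M × F × Finset V) :=
  {T | T.2.1 ∈ D.cellFaces T.1 ∧ T.2.2 ∈ D.faceEdges T.2.1}

/-- `D` is a generalized polyhedral discretization of `Ω` whose simplicial submesh is a
(nondegenerate, conforming) simplicial mesh. -/
structure IsMesh (D : MeshData d M F V) (Ω : Set (Space d)) : Prop where
  cell_open : ∀ κ, IsOpen (D.cell κ)
  cell_subset : ∀ κ, D.cell κ ⊆ Ω
  cell_disjoint : Pairwise fun κ κ' => Disjoint (D.cell κ) (D.cell κ')
  cell_cover : ⋃ κ, closure (D.cell κ) = closure Ω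
  center_mem : ∀ κ, D.cellCenter κ ∈ D.cell κ
  cell_star : ∀ κ, StarConvex ℝ (D.cellCenter κ) (D.cell κ)
  cell_frontier : ∀ κ, frontier (D.cell κ) = ⋃ σ ∈ D.cellFaces κ, D.faceSet σ
  face_cell : ∀ σ, ∃ κ, σ ∈ D.cellFaces κ
  vertex_cell : ∀ s, ∃ κ, s ∈ D.cellVerts κ
  edge_card : ∀ σ, ∀ e ∈ D.faceEdges σ, e.card = 2
  face_verts : ∀ σ, D.faceVerts σ = (D.faceEdges σ).biUnion id
  two_dim : d = 2 → ∀ σ, D.faceEdges σ = {D.faceVerts σ}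
  beta_nonneg : d = 3 → ∀ σ, ∀ s ∈ D.faceVerts σ, 0 ≤ D.beta σ s
  beta_sum : d = 3 → ∀ σ, ∑ s ∈ D.faceVerts σ, D.beta σ s = 1
  simplex_nondegenerate : ∀ T ∈ D.submesh,
    AffineIndependent ℝ (fun n : {n // n ∈ D.simplexNodes T} => D.nodePos n)
  simplex_conforming : ∀ T ∈ D.submesh, ∀ T' ∈ D.submesh,
    D.hull (D.simplexNodes T) ∩ D.hull (D.simplexNodes T')
      = D.hull (D.simplexNodes T ∩ D.simplexNodes T')

/-- `x` has the barycentric coordinates `w` in the simplex `T` of the submesh. -/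
def IsBary (D : MeshData d M F V) (x : Space d) (T : M × F × Finset V) (w : M ⊕ F ⊕ V → ℝ) :
    Prop :=
  T ∈ D.submesh ∧ (∀ n ∈ D.simplexNodes T, 0 ≤ w n) ∧ ∑ n ∈ D.simplexNodes T, w n = 1 ∧
    ∑ n ∈ D.simplexNodes T, w n • D.nodePos n = x

open Classical in
/-- The `P1` finite element reconstruction `π_T v`: affine on each simplex of the submesh, with the
prescribed values at its nodes (the value does not depend on the simplex that is chosen, since the
submesh is conforming). -/
def recon (D : MeshData d M F V) (v : W M V) (x : Space d) : ℝ :=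
  if h : ∃ q : (M × F × Finset V) × (M ⊕ F ⊕ V → ℝ), D.IsBary x q.1 q.2 then
    ∑ n ∈ D.simplexNodes h.choose.1, h.choose.2 n * D.nodeVal v n
  else 0

/-- The reconstructed gradient `∇_T v = ∇ π_T v` (defined almost everywhere). -/
def gradT (D : MeshData d M F V) (v : W M V) (x : Space d) : Space d := gradient (D.recon v) x

/-- The basis vector `e_s` of `W_D` attached to a vertex. -/
def basisVertex (s : V) : W M V := Pi.single (Sum.inr s) 1

/-- The local matrix `A_κ`. -/
def matA (D : MeshData d M F V) (L : Space d → Space d →L[ℝ] Space d) (κ : M) :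
    Matrix {s // s ∈ D.cellVerts κ} {s // s ∈ D.cellVerts κ} ℝ :=
  Matrix.of fun s s' => ∫ x in D.cell κ,
    inner ℝ (L x (D.gradT (basisVertex s.1) x)) (D.gradT (basisVertex s'.1) x)

/-- The local difference operator `(δ_κ v)_s = v_κ - v_s`. -/
def del (D : MeshData d M F V) (κ : M) (v : W M V) : {s // s ∈ D.cellVerts κ} → ℝ :=
  fun s => v (Sum.inl κ) - v (Sum.inr s.1)

/-- The averaged mobility `η_{κ,s}`. -/
def etaAvg (η : ℝ → ℝ) (u : W M V) (κ : M) (s : V) : ℝ :=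
  (η (u (Sum.inl κ)) + η (u (Sum.inr s))) / 2

/-- The diagonal matrix `M_κ(u)`. -/
def matM (D : MeshData d M F V) (η : ℝ → ℝ) (κ : M) (u : W M V) :
    Matrix {s // s ∈ D.cellVerts κ} {s // s ∈ D.cellVerts κ} ℝ :=
  Matrix.diagonal fun s => √(etaAvg η u κ s.1)

/-- The matrix `B_κ(u) = M_κ(u) A_κ M_κ(u)`. -/
def matB (D : MeshData d M F V) (L : Space d → Space d →L[ℝ] Space d) (η : ℝ → ℝ) (κ : M)
    (u : W M V) : Matrix {s // s ∈ D.cellVerts κ} {s // s ∈ D.cellVerts κ} ℝ :=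
  D.matM η κ u * D.matA L κ * D.matM η κ u

/-- The discrete exterior potential. -/
def potential (D : MeshData d M F V) (Vext : Space d → ℝ) : W M V :=
  Sum.elim (fun κ => Vext (D.cellCenter κ)) (fun s => Vext (D.vertexPos s))

/-- The discrete hydrostatic pressure `h(u) = p(u) + V`. -/
def hydro (D : MeshData d M F V) (p : ℝ → ℝ) (Vext : Space d → ℝ) (u : W M V) : W M V :=
  fun b => p (u b) + D.potential Vext b

/-- The flux `F_{κ,s}(u)` from the cell `κ` to its vertex `s`. -/
def fluxCV (D : MeshData d M F V) (L : Space d → Space d →L[ℝ] Space d) (η p : ℝ → ℝ)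
    (Vext : Space d → ℝ) (u : W M V) (κ : M) (s : {s // s ∈ D.cellVerts κ}) : ℝ :=
  √(etaAvg η u κ s.1) * ∑ s' : {s // s ∈ D.cellVerts κ}, D.matA L κ s s' *
    √(etaAvg η u κ s'.1) *
      (D.hydro p Vext u (Sum.inl κ) - D.hydro p Vext u (Sum.inr s'.1))

/-- The flux `F_{s,κ}(u) = -F_{κ,s}(u)` from the vertex `s` to the cell `κ`. -/
def fluxVC (D : MeshData d M F V) (L : Space d → Space d →L[ℝ] Space d) (η p : ℝ → ℝ)
    (Vext : Space d → ℝ) (u : W M V) (κ : M) (s : {s // s ∈ D.cellVerts κ}) : ℝ :=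
  -D.fluxCV L η p Vext u κ s

end MeshData

/-! ### Mass lumping, discrete entropy, scheme -/

/-- Data of a mass lumping: the weights `α_{κ,s}`, and the sets `ω_κ`, `ω_{κ,s}`. -/
structure Lumping (d : ℕ) (M V : Type*) where
  alpha : M → V → ℝ
  omegaCell : M → Set (Space d)
  omegaCV : M → V → Set (Space d)

namespace Lumping

variable {d : ℕ} {M F V : Type*} [Fintype M] [Fintype F] [Fintype V]
  [DecidableEq M] [DecidableEq F] [DecidableEq V]

/-- `m_{κ,s} = α_{κ,s} meas(κ)`. -/
def massCV (P : Lumping d M V) (D : MeshData d M F V) (κ : M) (s : V) : ℝ :=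
  P.alpha κ s * volume.real (D.cell κ)

/-- The lumped masses `m_κ` and `m_s`. -/
def mass (P : Lumping d M V) (D : MeshData d M F V) : W M V :=
  Sum.elim
    (fun κ => volume.real (D.cell κ) - ∑ s ∈ D.cellVerts κ, P.massCV D κ s)
    (fun s => ∑ κ ∈ D.vertexCells s, P.massCV D κ s)

/-- The admissible mass lumpings for the mesh `D`. -/
structure IsLumping (P : Lumping d M V) (D : MeshData d M F V) : Prop where
  alpha_nonneg : ∀ κ, ∀ s ∈ D.cellVerts κ, 0 ≤ P.alpha κ s
  alpha_sum : ∀ κ, ∑ s ∈ D.cellVerts κ, P.alpha κ s ≤ 1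
  omegaCell_open : ∀ κ, IsOpen (P.omegaCell κ)
  omegaCV_open : ∀ κ, ∀ s ∈ D.cellVerts κ, IsOpen (P.omegaCV κ s)
  omegaCell_subset : ∀ κ, P.omegaCell κ ⊆ D.cell κ
  omegaCV_subset : ∀ κ, ∀ s ∈ D.cellVerts κ, P.omegaCV κ s ⊆ D.cell κ
  disjoint_cell : ∀ κ, ∀ s ∈ D.cellVerts κ, Disjoint (P.omegaCell κ) (P.omegaCV κ s)
  disjoint_cv : ∀ κ, ∀ s ∈ D.cellVerts κ, ∀ s' ∈ D.cellVerts κ, s ≠ s' →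
    Disjoint (P.omegaCV κ s) (P.omegaCV κ s')
  cover : ∀ κ, closure (P.omegaCell κ) ∪ ⋃ s ∈ D.cellVerts κ, closure (P.omegaCV κ s)
    = closure (D.cell κ)
  meas_cell : ∀ κ, volume.real (P.omegaCell κ) = P.mass D (Sum.inl κ)
  meas_cv : ∀ κ, ∀ s ∈ D.cellVerts κ, volume.real (P.omegaCV κ s) = P.massCV D κ s

/-- The set `ω_s`, the union of the `ω_{κ,s}` over the cells sharing the vertex `s`. -/
def omegaVertex (P : Lumping d M V) (D : MeshData d M F V) (s : V) : Set (Space d) :=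
  ⋃ κ ∈ D.vertexCells s, P.omegaCV κ s

/-- The piecewise constant reconstruction `π_D v`. -/
def reconD (P : Lumping d M V) (D : MeshData d M F V) (v : W M V) (x : Space d) : ℝ :=
  ∑ κ, (P.omegaCell κ).indicator (fun _ => v (Sum.inl κ)) x
    + ∑ s, (P.omegaVertex D s).indicator (fun _ => v (Sum.inr s)) x

/-- The discrete entropy `∫_Ω (Γ(π_D v) + π_D v π_D V) dx ∈ (-∞,+∞]`. Since `Γ ≥ 0`, the first part
is an integral with values in `[0,+∞]`; the second one is the integral of a bounded function. -/
def entropyD (P : Lumping d M V) (D : MeshData d M F V) (Ω : Set (Space d)) (p : ℝ → ℝ)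
    (Vext : Space d → ℝ) (v : W M V) : EReal :=
  ((∫⁻ x in Ω, Gam p (P.reconD D v x) : ℝ≥0∞) : EReal)
    + ((∫ x in Ω, P.reconD D v x * P.reconD D (D.potential Vext) x : ℝ) : EReal)

/-- The set `W_D^en` of the vectors of finite discrete entropy. -/
def FiniteEntropy (P : Lumping d M V) (D : MeshData d M F V) (Ω : Set (Space d)) (p : ℝ → ℝ)
    (Vext : Space d → ℝ) : Set (W M V) :=
  {v | P.entropyD D Ω p Vext v < ⊤}

/-- `u` solves the nonlinear system of the scheme with time step `dt` and previous state `uOld`. -/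
def SolvesScheme (P : Lumping d M V) (D : MeshData d M F V)
    (L : Space d → Space d →L[ℝ] Space d) (η p : ℝ → ℝ) (Vext : Space d → ℝ) (dt : ℝ)
    (uOld u : W M V) : Prop :=
  (∀ κ : M, P.mass D (Sum.inl κ) * ((u (Sum.inl κ) - uOld (Sum.inl κ)) / dt)
      + ∑ s : {s // s ∈ D.cellVerts κ}, D.fluxCV L η p Vext u κ s = 0) ∧
  (∀ s : V, P.mass D (Sum.inr s) * ((u (Sum.inr s) - uOld (Sum.inr s)) / dt)
      + ∑ κ : {κ // s ∈ D.cellVerts κ}, D.fluxVC L η p Vext u κ.1 ⟨s, κ.2⟩ = 0)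

end Lumping

/-- The set `W_D^ad` of the admissible states. -/
def Admissible (M V : Type*) (p : ℝ → ℝ) : Set (W M V) := {v | ∀ b, v b ∈ Ip p}

end

end VAG

/-!
The hydrostatic pressure `z = h(u)` is a better unknown than `u`: since `p` maps `I_p` increasingly
onto `ℝ`, every `z` is the hydrostatic pressure of exactly one admissible state, `u = p⁻¹(z - V)`.
Pairing the residual of the scheme with `z` gives the sum of the mass terms
`m_β (u_β - u_β^{n-1}) z_β / Δt` and of the dissipations `δ_κ z · B_κ(u) δ_κ z ≥ 0`. Each matrix
`A_κ` is positive definite, because a combination of the basis functions of the vertices of `κ` that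
is constant on a simplex of the submesh vanishes there, as it vanishes at `x_κ`.

The mass terms are bounded below, so on the set where the residual does not point strictly outwards
every mass term and every dissipation is bounded. The mass term of a node bounds `z_β` from above,
and also from below if `u_β^{n-1}` is interior to `I_p`. If `p(0) = -∞`, the positivity of the total
mass provides one such node; a lower bound at a node keeps the mobility there away from zero, so
the dissipation bounds the neighbouring jumps of `z`, and the lower bound spreads to all nodes since
`Ω` is connected. The residual thus points outwards on a large sphere, and therefore has a zero.

The last implication is a form of Brouwer's theorem. Failing it, there would be a smooth retraction
`r` of a ball onto its sphere. For small `t` the map `id + t (r - id)` is a bijection of the ball,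
so the integral of its Jacobian determinant is the volume of the ball. This integral is a polynomial
in `t`, hence also equal to the volume at `t = 1`, where however the determinant of `Dr` vanishes.

For the energy inequality, the tangent inequality `Γ(u) - Γ(w) ≤ (p(u) - p(1)) (u - w)` is summed
against the masses; the term with `p(1)` vanishes by conservation of mass, and testing the scheme
with `h(u)` turns the remaining one into the dissipation.
-/

namespace VAG

/-! ### Zeros of coercive vector fields -/

section Brouwer

lemma inter_frontier_nonempty_of_isPreconnected {X : Type*} [TopologicalSpace X] {s t : Set X}
    (ht : IsPreconnected t) (hs : (t ∩ s).Nonempty) (hsc : (t ∩ sᶜ).Nonempty) :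
    (t ∩ frontier s).Nonempty := by
  by_contra! hempty
  have hcover : t ⊆ interior s ∪ interior sᶜ := by
    rw [← compl_frontier_eq_union_interior]
    exact fun x hx hxs => hempty.subset ⟨hx, hxs⟩
  obtain ⟨x, hx, hxs⟩ := hs
  obtain ⟨y, hy, hys⟩ := hsc
  obtain ⟨z, -, hzs, hzsc⟩ := ht _ _ isOpen_interior isOpen_interior hcover
    ⟨x, hx, (hcover hx).resolve_right fun h => interior_subset h hxs⟩
    ⟨y, hy, (hcover hy).resolve_left fun h => hys (interior_subset h)⟩
  exact interior_subset hzsc (interior_subset hzs)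

lemma lipschitzWith_indicator_of_eq_zero_on_frontier {E F : Type*} [NormedAddCommGroup E]
    [NormedSpace ℝ E] [SeminormedAddCommGroup F] {s : Set E} (hs : IsClosed s) {g : E → F}
    {K : ℝ≥0} (hg : LipschitzOnWith K g s) (h0 : ∀ x ∈ frontier s, g x = 0) :
    LipschitzWith K (s.indicator g) := by
  have norm_le_of_notMem : ∀ x ∈ s, ∀ y ∉ s, ‖g x‖ ≤ K * dist x y := by
    intro x hx y hy
    obtain ⟨z, hz, hzs⟩ : (segment ℝ x y ∩ frontier s).Nonempty :=
      inter_frontier_nonempty_of_isPreconnected (convex_segment x y).isPreconnected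
        ⟨x, left_mem_segment ℝ x y, hx⟩ ⟨y, right_mem_segment ℝ x y, hy⟩
    calc ‖g x‖ = dist (g x) (g z) := by rw [h0 z hzs, dist_zero_right]
      _ ≤ K * dist x z := hg.dist_le_mul x hx z (hs.frontier_subset hzs)
      _ ≤ K * dist x y := by
          have := dist_add_dist_of_mem_segment hz
          gcongr
          linarith [dist_nonneg (x := z) (y := y)]
  refine LipschitzWith.of_dist_le_mul fun x y => ?_
  by_cases hx : x ∈ s <;> by_cases hy : y ∈ s
  · simpa [hx, hy] using hg.dist_le_mul x hx y hy
  · simpa [hx, hy] using norm_le_of_notMem x hx y hy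
  · simpa [hx, hy, dist_comm] using norm_le_of_notMem y hy x hx
  · simp only [indicator_of_notMem hx, indicator_of_notMem hy, dist_self]
    positivity

lemma bijective_id_add_of_lipschitzWith {E : Type*} [NormedAddCommGroup E] [CompleteSpace E]
    {h : E → E} {K : ℝ≥0} (hh : LipschitzWith K h) (hK : K < 1) :
    Function.Bijective fun x => x + h x := by
  constructor
  · intro x y hxy
    have hle : dist x y ≤ K * dist x y := by
      calc dist x y = dist (h y) (h x) := by
            rw [dist_eq_norm, dist_eq_norm]
            congr 1
            rw [sub_eq_sub_iff_add_eq_add, add_comm (h y)]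
            exact hxy
        _ ≤ K * dist x y := by rw [dist_comm x]; exact hh.dist_le_mul y x
    have : (K : ℝ) < 1 := hK
    exact dist_le_zero.1 (by nlinarith [dist_nonneg (x := x) (y := y)])
  · intro y
    have hc : ContractingWith K fun x => y - h x :=
      ⟨hK, by simpa using (LipschitzWith.const y).sub hh⟩
    refine ⟨hc.fixedPoint, ?_⟩
    have := hc.fixedPoint_isFixedPt
    exact add_eq_of_eq_sub this.symm

lemma image_eq_self_of_bijective {α : Type*} {f : α → α} (hf : Function.Bijective f) {s : Set α}
    (hs : ∀ x ∉ s, f x = x) : f '' s = s := by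
  have himage : f '' sᶜ = sᶜ := by
    simpa using (image_congr hs : f '' sᶜ = id '' sᶜ)
  rw [image_compl_eq hf] at himage
  exact compl_injective himage

lemma exists_natDegree_le_det_one_add_smul {R M : Type*} [CommRing R] [Nontrivial R]
    [AddCommGroup M] [Module R M] [Module.Free R M] [Module.Finite R M] (f : M →ₗ[R] M) :
    ∃ q : Polynomial R, q.natDegree ≤ Module.finrank R M ∧
      ∀ t : R, LinearMap.det (1 + t • f) = q.eval t := by
  classical
  set b := Module.Free.chooseBasis R M
  set N := LinearMap.toMatrix b b f
  refine ⟨((Polynomial.X : Polynomial R) • N.map Polynomial.C +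
    (1 : Matrix _ _ R).map Polynomial.C).det, ?_, fun t => ?_⟩
  · rw [Module.finrank_eq_card_chooseBasisIndex]
    exact Polynomial.natDegree_det_X_add_C_le N 1
  · rw [← LinearMap.det_toMatrix b, ← Polynomial.coe_evalRingHom, RingHom.map_det]
    congr 1
    ext i j
    by_cases hij : i = j <;> simp [N, LinearMap.toMatrix_apply, hij] <;> ring

lemma exists_eval_eq_sum_mul_eval {k : Type*} [Field k] {S : Set k} (hS : S.Infinite) (n : ℕ)
    (x : k) : ∃ (s : Finset k) (c : k → k), (s : Set k) ⊆ S ∧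
      ∀ q : Polynomial k, q.natDegree ≤ n → q.eval x = ∑ t ∈ s, c t * q.eval t := by
  classical
  obtain ⟨s, hsS, hs⟩ := hS.exists_subset_card_eq (n + 1)
  refine ⟨s, fun t => (Lagrange.basis s id t).eval x, hsS, fun q hq => ?_⟩
  have hdeg : q.degree < s.card := by
    rw [hs]
    exact Polynomial.degree_le_natDegree.trans_lt (by exact_mod_cast Nat.lt_succ_of_le hq)
  conv_lhs => rw [Lagrange.eq_interpolate (injOn_id _) hdeg]
  simp [Lagrange.interpolate_apply, Polynomial.eval_finsetSum, mul_comm]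

section Measure

variable {E : Type*} [NormedAddCommGroup E] [NormedSpace ℝ E] [FiniteDimensional ℝ E]

lemma det_one_add_pos_of_norm_lt_one {A : E →L[ℝ] E} (hA : ‖A‖ < 1) : 0 < (1 + A).det := by
  have : CompleteSpace E := FiniteDimensional.complete ℝ E
  have hne : ∀ t ∈ Icc (0 : ℝ) 1, (1 + t • A).det ≠ 0 := by
    intro t ht
    have hunit : IsUnit (1 + t • A) := by
      have hnorm : ‖-(t • A)‖ < 1 := by
        rw [norm_neg, norm_smul, Real.norm_of_nonneg ht.1]
        exact (mul_le_of_le_one_left (norm_nonneg _) ht.2).trans_lt hA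
      simpa using isUnit_one_sub_of_norm_lt_one hnorm
    exact (LinearMap.isUnit_det _ (hunit.map ContinuousLinearMap.toLinearMapRingHom)).ne_zero
  have hc : Continuous fun t : ℝ => (1 + t • A).det :=
    ContinuousLinearMap.continuous_det.comp (by fun_prop)
  by_contra! hneg
  obtain ⟨t, ht, h⟩ := intermediate_value_Icc' (zero_le_one (α := ℝ)) hc.continuousOn
    (show (0 : ℝ) ∈ _ by simpa [ContinuousLinearMap.det] using hneg)
  exact hne t ht h

variable [MeasurableSpace E] [BorelSpace E] (μ : Measure E) [μ.IsAddHaarMeasure]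

lemma integral_det_one_add_fderiv_of_lipschitzOnWith {g : E → E} {U : Set E} (hU : IsOpen U)
    (hg : DifferentiableOn ℝ g U) {K : ℝ≥0} (hgK : LipschitzOnWith K g (closure U)) (hK : K < 1)
    (h0 : ∀ x ∈ frontier U, g x = 0) :
    ∫ x in U, (1 + fderiv ℝ g x).det ∂μ = μ.real U := by
  have : CompleteSpace E := FiniteDimensional.complete ℝ E
  set G := (closure U).indicator g with hG
  have hbij : Function.Bijective fun x => x + G x :=
    bijective_id_add_of_lipschitzWith (lipschitzWith_indicator_of_eq_zero_on_frontier
      isClosed_closure hgK fun x hx => h0 x (frontier_closure_subset hx)) hK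
  have himage : (fun x => x + G x) '' U = U := by
    refine image_eq_self_of_bijective hbij fun x hx => ?_
    by_cases hxU : x ∈ closure U
    · simp [hG, hxU, h0 x (hU.frontier_eq ▸ ⟨hxU, hx⟩)]
    · simp [hG, hxU]
  have hderiv : ∀ x ∈ U, HasFDerivWithinAt (fun x => x + G x) (1 + fderiv ℝ g x) U x := by
    intro x hx
    have hgx := (hg.differentiableAt (hU.mem_nhds hx)).hasFDerivAt.hasFDerivWithinAt (s := U)
    have hGg : ∀ y ∈ U, y + G y = id y + g y := fun y hy => by simp [hG, subset_closure hy]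
    exact ((hasFDerivWithinAt_id x U).add hgx).congr hGg (hGg x hx)
  have hdet : ∀ x ∈ U, |(1 + fderiv ℝ g x).det| = (1 + fderiv ℝ g x).det := fun x hx =>
    abs_of_pos <| det_one_add_pos_of_norm_lt_one <| lt_of_le_of_lt
      (norm_fderiv_le_of_lipschitzOn ℝ (hU.mem_nhds hx) (hgK.mono subset_closure)) hK
  have hchange := integral_image_eq_integral_abs_det_fderiv_smul μ hU.measurableSet hderiv
    hbij.1.injOn fun _ => (1 : ℝ)
  rw [himage] at hchange
  calc ∫ x in U, (1 + fderiv ℝ g x).det ∂μ = ∫ x in U, |(1 + fderiv ℝ g x).det| • (1 : ℝ) ∂μ :=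
        setIntegral_congr_fun hU.measurableSet fun x hx => by simp [hdet x hx]
    _ = μ.real U := by rw [← hchange]; simp

lemma exists_pos_forall_integral_det_one_add_smul_fderiv {g : E → E} (hg : ContDiff ℝ 1 g)
    {U : Set E} (hU : IsOpen U) (hUb : Bornology.IsBounded U) (h0 : ∀ x ∈ frontier U, g x = 0) :
    ∃ ε > 0, ∀ t ∈ Ioo (0 : ℝ) ε, ∫ x in U, (1 + t • fderiv ℝ g x).det ∂μ = μ.real U := by
  obtain ⟨K, hK⟩ := (hg.locallyLipschitz.locallyLipschitzOn
    (s := closure U)).exists_lipschitzOnWith_of_compact hUb.isCompact_closure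
  refine ⟨(K + 1 : ℝ)⁻¹, by positivity, fun t ht => ?_⟩
  have htK : t.toNNReal * K < 1 := by
    rw [← NNReal.coe_lt_coe, NNReal.coe_mul, Real.coe_toNNReal t ht.1.le, NNReal.coe_one]
    have := (lt_inv_comm₀ ht.1 (by positivity)).1 ht.2
    rw [← lt_div_iff₀' ht.1, one_div]
    linarith
  have hlip : LipschitzOnWith (t.toNNReal * K) (t • g) (closure U) := by
    refine LipschitzOnWith.of_dist_le_mul fun x hx y hy => ?_
    simp only [Pi.smul_apply, dist_smul₀, NNReal.coe_mul, Real.coe_toNNReal t ht.1.le,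
      Real.norm_of_nonneg ht.1.le, mul_assoc]
    exact mul_le_mul_of_nonneg_left (hK.dist_le_mul x hx y hy) ht.1.le
  simpa [fderiv_const_smul_field] using integral_det_one_add_fderiv_of_lipschitzOnWith μ hU
    ((hg.differentiable one_ne_zero).const_smul t).differentiableOn hlip htK
    fun x hx => by simp [h0 x hx]

-- The integral of `det (1 + t • Dg)` is a polynomial in `t`, and it is constant for small `t`.
lemma integral_det_one_add_fderiv {g : E → E} (hg : ContDiff ℝ 1 g) {U : Set E} (hU : IsOpen U)
    (hUb : Bornology.IsBounded U) (h0 : ∀ x ∈ frontier U, g x = 0) :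
    ∫ x in U, (1 + fderiv ℝ g x).det ∂μ = μ.real U := by
  obtain ⟨ε, hε, hsmall⟩ := exists_pos_forall_integral_det_one_add_smul_fderiv μ hg hU hUb h0
  obtain ⟨s, c, hs, hc⟩ := exists_eval_eq_sum_mul_eval (Ioo_infinite hε) (Module.finrank ℝ E) 1
  have hdet : ∀ A : E →L[ℝ] E, (1 + A).det = ∑ t ∈ s, c t * (1 + t • A).det := by
    intro A
    obtain ⟨q, hq, hqt⟩ := exists_natDegree_le_det_one_add_smul (A : E →ₗ[ℝ] E)
    have h1 := hc q hq
    simp only [← hqt, one_smul] at h1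
    exact h1
  have hint : ∀ t : ℝ, IntegrableOn (fun x => (1 + t • fderiv ℝ g x).det) U μ := fun t =>
    have := hg.continuous_fderiv one_ne_zero
    ((ContinuousLinearMap.continuous_det.comp (by fun_prop)).continuousOn.integrableOn_compact
      hUb.isCompact_closure).mono_set subset_closure
  calc ∫ x in U, (1 + fderiv ℝ g x).det ∂μ
      = ∑ t ∈ s, c t * ∫ x in U, (1 + t • fderiv ℝ g x).det ∂μ := by
        simp_rw [← integral_const_mul]
        rw [← integral_finsetSum s fun t _ => (hint t).const_mul (c t)]
        simp_rw [← hdet]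
    _ = (∑ t ∈ s, c t) * μ.real U := by
        rw [Finset.sum_mul]
        exact Finset.sum_congr rfl fun t ht => by rw [hsmall t (hs ht)]
    _ = μ.real U := by
        have hsum : 1 = ∑ t ∈ s, c t := by simpa using hc 1 (by simp)
        rw [← hsum, one_mul]

end Measure

variable {E : Type*} [NormedAddCommGroup E] [InnerProductSpace ℝ E]

lemma det_eq_zero_of_hasFDerivAt_of_norm_eq [FiniteDimensional ℝ E] {r : E → E} {A : E →L[ℝ] E}
    {x : E} (hr : HasFDerivAt r A x) {R : ℝ} (hR : R ≠ 0) (hn : ∀ y, ‖r y‖ = R) : A.det = 0 := by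
  have horth : ∀ w, inner ℝ (r x) (A w) = 0 := by
    intro w
    have hconst : (fun y => ‖r y‖ ^ 2) = fun _ => R ^ 2 := by simp [hn]
    have h := hr.norm_sq.unique (hconst ▸ hasFDerivAt_const (R ^ 2) x)
    simpa using congrArg (fun f => f w) h
  by_contra hne
  obtain ⟨w, hw⟩ := (LinearMap.equivOfDetNeZero _ hne).surjective (r x)
  replace hw : A w = r x := hw
  have := horth w
  rw [hw, real_inner_self_eq_norm_sq, hn] at this
  exact pow_ne_zero 2 hR this

lemma exists_mem_frontier_ne_of_norm_eq [FiniteDimensional ℝ E] {r : E → E}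
    (hr : ContDiff ℝ 1 r) {R : ℝ} (hR : R ≠ 0) (hn : ∀ x, ‖r x‖ = R) {U : Set E} (hU : IsOpen U)
    (hUb : Bornology.IsBounded U) (hne : U.Nonempty) : ∃ x ∈ frontier U, r x ≠ x := by
  borelize E
  by_contra! hid
  have hfderiv : ∀ x, 1 + fderiv ℝ (fun y => r y - y) x = fderiv ℝ r x := by
    intro x
    rw [fderiv_fun_sub (hr.differentiable one_ne_zero x) differentiableAt_fun_id, fderiv_fun_id]
    exact add_sub_cancel _ _
  have hvol := integral_det_one_add_fderiv (volume : Measure E) (hr.sub contDiff_id) hU hUb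
    fun x hx => by simp [hid x hx]
  have hsing : ∀ x, (fderiv ℝ r x).det = 0 := fun x =>
    det_eq_zero_of_hasFDerivAt_of_norm_eq (hr.differentiable one_ne_zero x).hasFDerivAt hR hn
  simp only [id, hfderiv, hsing, integral_zero] at hvol
  exact (ENNReal.toReal_pos (hU.measure_pos volume hne).ne' hUb.measure_lt_top.ne).ne hvol

lemma exists_eq_zero_of_eq_self_of_le_norm [FiniteDimensional ℝ E] {H : E → E}
    (hH : Continuous H) {R : ℝ} (hid : ∀ x, R ≤ ‖x‖ → H x = x) : ∃ x, H x = 0 := by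
  by_contra! hne
  obtain ⟨S, hRS, hS⟩ : ∃ S, R < S ∧ 0 < S := ⟨max R 0 + 1, by grind, by positivity⟩
  obtain ⟨K, hK, happrox, hKS, -⟩ := hH.exists_contDiff_approx_and_eqOn 1 (ε := fun x => ‖H x‖)
    hH.norm (fun x => norm_pos_iff.2 (hne x)) (S := {x | S ≤ ‖x‖}) (U := {x | R < ‖x‖})
    (isClosed_le continuous_const continuous_norm)
    ((isOpen_lt continuous_const continuous_norm).mem_nhdsSet.2 fun _ hx => hRS.trans_le hx)
    (contDiff_id.contDiffOn.congr fun x (hx : R < ‖x‖) => hid x hx.le)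
  have hK0 : ∀ x, K x ≠ 0 := fun x h => by simpa [h] using happrox x
  obtain ⟨x, hx, hxne⟩ := exists_mem_frontier_ne_of_norm_eq (r := fun x => (S / ‖K x‖) • K x)
    (.smul (contDiff_const.div (hK.norm ℝ hK0) fun x => norm_ne_zero_iff.2 (hK0 x)) hK) hS.ne'
    (fun x => by simp [norm_smul, hK0 x, hS.le]) Metric.isOpen_ball
    (Metric.isBounded_ball (x := (0 : E)) (r := S)) ⟨0, by simpa⟩
  have hxS : ‖x‖ = S := by simpa using Metric.frontier_ball_subset_sphere hx
  have hKx : K x = x := (hKS hxS.ge).trans (hid x (hRS.le.trans_eq hxS.symm))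
  simp [hKx, hxS, hS.ne'] at hxne

lemma exists_continuous_radial_retraction {R : ℝ} (hR : 0 < R) : ∃ π : E → E, Continuous π ∧
    (∀ x, ‖x‖ ≤ R → π x = x) ∧ ∀ x, R ≤ ‖x‖ → ‖π x‖ = R ∧ ∃ t : ℝ, 0 < t ∧ π x = t • x := by
  have hmax : ∀ x : E, 0 < max R ‖x‖ := fun x => hR.trans_le (le_max_left _ _)
  refine ⟨fun x => (R / max R ‖x‖) • x, ?_, fun x hx => ?_, fun x hx =>
    ⟨?_, R / max R ‖x‖, ?_, rfl⟩⟩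
  · have : Continuous fun x : E => R / max R ‖x‖ :=
      continuous_const.div (by fun_prop) fun x => (hmax x).ne'
    fun_prop
  · simp [max_eq_left hx, hR.ne']
  · have : ‖x‖ ≠ 0 := (hR.trans_le hx).ne'
    simp [max_eq_right hx, norm_smul, abs_of_pos hR, this]
  · exact div_pos hR (hmax x)

theorem exists_eq_zero_of_inner_nonneg [FiniteDimensional ℝ E] {G : E → E} {R : ℝ} (hR : 0 < R)
    (hG : ContinuousOn G (Metric.closedBall 0 R))
    (hpos : ∀ x, ‖x‖ = R → 0 ≤ inner ℝ (G x) x) : ∃ x ∈ Metric.closedBall 0 R, G x = 0 := by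
  obtain ⟨π, hπc, hπ_eq, hπ_sphere⟩ := exists_continuous_radial_retraction (E := E) hR
  have hπ_mem : ∀ x, π x ∈ Metric.closedBall (0 : E) R := fun x => by
    rw [mem_closedBall_zero_iff]
    rcases le_total ‖x‖ R with hx | hx
    · rwa [hπ_eq x hx]
    · exact (hπ_sphere x hx).1.le
  set θ : E → ℝ := fun x => max 0 (min 1 (‖x‖ - R))
  have hHc : Continuous fun x => (1 - θ x) • G (π x) + θ x • x := by
    have hGπ : Continuous fun x => G (π x) := hG.comp_continuous hπc hπ_mem
    have hθ : Continuous θ := by fun_prop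
    exact ((continuous_const.sub hθ).smul hGπ).add (hθ.smul continuous_id)
  obtain ⟨x, hx⟩ := exists_eq_zero_of_eq_self_of_le_norm (R := R + 1) hHc
    fun x hx => by simp [θ, min_eq_left (show (1 : ℝ) ≤ ‖x‖ - R by linarith)]
  refine ⟨π x, hπ_mem x, ?_⟩
  rcases le_or_gt ‖x‖ R with hxR | hxR
  · simpa [θ, hπ_eq x hxR, max_eq_left (min_le_of_right_le (sub_nonpos.2 hxR))] using hx
  · exfalso
    have hθ : 0 < θ x := lt_max_of_lt_right (lt_min one_pos (sub_pos.2 hxR))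
    have hθ1 : θ x ≤ 1 := max_le zero_le_one (min_le_left _ _)
    have hinner : 0 ≤ inner ℝ (G (π x)) x := by
      obtain ⟨hnorm, t, ht, hπx⟩ := hπ_sphere x hxR.le
      have h : 0 ≤ inner ℝ (G (π x)) (t • x) := hπx ▸ hpos (π x) hnorm
      rw [real_inner_smul_right] at h
      exact nonneg_of_mul_nonneg_right h ht
    have hzero := congrArg (fun y => inner ℝ y x) hx
    simp only [inner_add_left, real_inner_smul_left, real_inner_self_eq_norm_sq,
      inner_zero_left] at hzero
    have : 0 < ‖x‖ ^ 2 := pow_pos (hR.trans hxR) 2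
    nlinarith [mul_pos hθ this, mul_nonneg (sub_nonneg.2 hθ1) hinner]

end Brouwer

/-! ### Pressure and entropy functions -/

lemma bddAbove_setOf_sub_mul_add_le {q : ℝ → ℝ} (hq : Monotone q) {w : ℝ} (hw : ∃ y, w < q y)
    (c C : ℝ) : BddAbove {y | (q y - w) * (y + c) ≤ C} := by
  obtain ⟨y₀, hy₀⟩ := hw
  have hδ : 0 < q y₀ - w := sub_pos.2 hy₀
  refine ⟨max y₀ (max C 0 / (q y₀ - w) - c), fun y (hy : (q y - w) * (y + c) ≤ C) => ?_⟩
  by_contra! h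
  obtain ⟨hyy₀, hyc⟩ := max_lt_iff.1 h
  have hC : max C 0 < (q y₀ - w) * (y + c) := (div_lt_iff₀' hδ).1 (by linarith)
  have hpos : 0 < y + c := pos_of_mul_pos_right ((le_max_right C 0).trans_lt hC) hδ.le
  have := mul_le_mul_of_nonneg_right (sub_le_sub_right (hq hyy₀.le) w) hpos.le
  linarith [le_max_left C 0]

lemma bddBelow_setOf_sub_mul_add_le {q : ℝ → ℝ} (hq : Monotone q) {w : ℝ} (hw : ∃ y, q y < w)
    (c C : ℝ) : BddBelow {y | (q y - w) * (y + c) ≤ C} := by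
  obtain ⟨y₀, hy₀⟩ := hw
  have hneg : Monotone fun y => -q (-y) := fun a b hab => neg_le_neg (hq (neg_le_neg hab))
  have h := bddAbove_setOf_sub_mul_add_le hneg (w := -w) ⟨-y₀, by simpa⟩ (-c) C
  have hset : {y | (q y - w) * (y + c) ≤ C} = -{y | (-q (-y) - -w) * (y + -c) ≤ C} := by
    ext y
    simp only [Set.mem_neg, mem_ofPred_eq, neg_neg]
    ring_nf
  exact hset ▸ h.neg

lemma intervalIntegral_le_mul_sub {f : ℝ → ℝ} {a b c : ℝ} (hf : IntervalIntegrable f volume a b)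
    (hle : ∀ x ∈ Ioo a b, f x ≤ c) (hge : ∀ x ∈ Ioo b a, c ≤ f x) :
    ∫ x in a..b, f x ≤ c * (b - a) := by
  rcases le_total a b with h | h
  · have := intervalIntegral.integral_mono_on_of_le_Ioo h hf intervalIntegrable_const hle
    rwa [intervalIntegral.integral_const, smul_eq_mul, mul_comm] at this
  · have := intervalIntegral.integral_mono_on_of_le_Ioo h intervalIntegrable_const hf.symm hge
    rw [intervalIntegral.integral_const, smul_eq_mul] at this
    rw [intervalIntegral.integral_symm]
    linarith

lemma Ip_of_singular {p : ℝ → ℝ} (h : PressureSingular p) : Ip p = Ioi 0 := by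
  ext u
  simp [Ip, h]

lemma Ip_of_not_singular {p : ℝ → ℝ} (h : ¬PressureSingular p) : Ip p = univ := by
  ext u
  simp [Ip, h]

lemma isOpen_Ip (p : ℝ → ℝ) : IsOpen (Ip p) := by
  by_cases h : PressureSingular p
  · rw [Ip_of_singular h]; exact isOpen_Ioi
  · rw [Ip_of_not_singular h]; exact isOpen_univ

lemma mem_Ip_of_pos {p : ℝ → ℝ} {u : ℝ} (hu : 0 < u) : u ∈ Ip p := fun _ => hu

lemma mem_Ip_of_lt {p : ℝ → ℝ} {u w : ℝ} (hw : w ∈ closure (Ip p)) (h : w < u) : u ∈ Ip p := by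
  intro hs
  rw [Ip_of_singular hs, closure_Ioi, mem_Ici] at hw
  exact hw.trans_lt h

lemma ordConnected_Ip (p : ℝ → ℝ) : (Ip p).OrdConnected :=
  ⟨fun _ hx _ _ _ hz hs => (hx hs).trans_le hz.1⟩

lemma exists_mem_Ip_lt {p : ℝ → ℝ} {w : ℝ} (hw : w ∈ Ip p) : ∃ u ∈ Ip p, u < w := by
  obtain ⟨l, hl, h⟩ := exists_Ioc_subset_of_mem_nhds ((isOpen_Ip p).mem_nhds hw) ⟨w - 1, by simp⟩
  exact ⟨(l + w) / 2, h ⟨by linarith, by linarith⟩, by linarith⟩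

namespace IsPressure

variable {η p : ℝ → ℝ}

lemma continuousOn_Ioi (hp : IsPressure η p) : ContinuousOn p (Ioi 0) := by
  intro u hu
  have hu : 0 < u := hu
  have h := (hp.absolutelyContinuous (u / 2) (2 * u) (by linarith) (by linarith)).continuousOn
  rw [uIcc_of_le (by linarith)] at h
  exact (h.continuousAt (Icc_mem_nhds (by linarith) (by linarith))).continuousWithinAt

lemma tendsto_zero (hp : IsPressure η p) (h : ¬PressureSingular p) :
    Tendsto p (𝓝[>] 0) (𝓝 (p 0)) := (hp.extension.resolve_left h).1

lemma neg_eq (hp : IsPressure η p) (h : ¬PressureSingular p) (u : ℝ) :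
    p (-u) = 2 * p 0 - p u := by
  have h2 := (hp.extension.resolve_left h).2
  rcases le_total 0 u with hu | hu
  · rw [h2 (-u) (by linarith), neg_neg]
  · rw [h2 u hu]; ring

lemma continuousOn_Ici (hp : IsPressure η p) (h : ¬PressureSingular p) :
    ContinuousOn p (Ici 0) := by
  intro u hu
  rcases (show (0 : ℝ) ≤ u from hu).eq_or_lt with rfl | hu
  · rw [← continuousWithinAt_Ioi_iff_Ici]
    exact hp.tendsto_zero h
  · exact (hp.continuousOn_Ioi.continuousAt (Ioi_mem_nhds hu)).continuousWithinAt

lemma strictMonoOn_Ici (hp : IsPressure η p) (h : ¬PressureSingular p) :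
    StrictMonoOn p (Ici 0) := by
  intro a ha b _ hab
  have hb : 0 < b := (show (0 : ℝ) ≤ a from ha).trans_lt hab
  rcases (show (0 : ℝ) ≤ a from ha).eq_or_lt with rfl | ha'
  · refine lt_of_le_of_lt (b := p (b / 2)) ?_
      (hp.strictMono (half_pos hb) hb (half_lt_self hb))
    refine le_of_tendsto (hp.tendsto_zero h) ?_
    filter_upwards [Ioo_mem_nhdsGT (half_pos hb)] with u hu
    exact (hp.strictMono hu.1 (half_pos hb) hu.2).le
  · exact hp.strictMono ha' hb hab

lemma strictMono_of_not_singular (hp : IsPressure η p) (h : ¬PressureSingular p) :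
    StrictMono p := by
  refine StrictMonoOn.Iic_union_Ici (a := 0) ?_ (hp.strictMonoOn_Ici h)
  intro a ha b hb hab
  have h1 := hp.strictMonoOn_Ici h (mem_Ici.2 (neg_nonneg.2 hb)) (mem_Ici.2 (neg_nonneg.2 ha))
    (neg_lt_neg hab)
  rw [hp.neg_eq h, hp.neg_eq h] at h1
  linarith

lemma continuous_of_not_singular (hp : IsPressure η p) (h : ¬PressureSingular p) :
    Continuous p := by
  rw [← continuousOn_univ, ← Iic_union_Ici (a := (0 : ℝ))]
  refine ContinuousOn.union_of_isClosed ?_ (hp.continuousOn_Ici h) isClosed_Iic isClosed_Ici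
  have h1 : ContinuousOn (fun u => 2 * p 0 - p (-u)) (Iic 0) :=
    continuousOn_const.sub ((hp.continuousOn_Ici h).comp continuousOn_neg
      fun u (hu : u ≤ 0) => show 0 ≤ -u by linarith)
  exact h1.congr fun u _ => by simp only [hp.neg_eq h]; ring

lemma strictMonoOn_Ip (hp : IsPressure η p) : StrictMonoOn p (Ip p) := by
  by_cases h : PressureSingular p
  · rw [Ip_of_singular h]; exact hp.strictMono
  · exact (hp.strictMono_of_not_singular h).strictMonoOn _

lemma continuousOn_Ip (hp : IsPressure η p) : ContinuousOn p (Ip p) := by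
  by_cases h : PressureSingular p
  · rw [Ip_of_singular h]; exact hp.continuousOn_Ioi
  · exact (hp.continuous_of_not_singular h).continuousOn

lemma surjOn_Ip (hp : IsPressure η p) : SurjOn p (Ip p) univ := by
  intro y _
  have hhigh : ∀ y, ∃ b, 0 < b ∧ y ≤ p b := fun y =>
    ((eventually_gt_atTop 0).and (hp.tendsto_atTop.eventually_ge_atTop y)).exists
  obtain ⟨b, hb, hyb⟩ := hhigh y
  obtain ⟨a, ha, hya⟩ : ∃ a ∈ Ip p, p a ≤ y := by
    by_cases h : PressureSingular p
    · obtain ⟨a, hya, ha⟩ :=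
        ((Tendsto.eventually_le_atBot h y).and eventually_mem_nhdsWithin).exists
      exact ⟨a, mem_Ip_of_pos ha, hya⟩
    · obtain ⟨a, -, ha⟩ := hhigh (2 * p 0 - y)
      refine ⟨-a, fun h' => absurd h' h, ?_⟩
      rw [hp.neg_eq h]
      linarith
  exact (ordConnected_Ip p).isPreconnected.intermediate_value ha (mem_Ip_of_pos hb)
    hp.continuousOn_Ip ⟨hya, hyb⟩

end IsPressure

/-- The inverse of the pressure function, a continuous increasing map from `ℝ` onto `I_p` as soon as
`IsPressure η p` holds. -/
noncomputable def pressureInv (p : ℝ → ℝ) : ℝ → ℝ := Function.invFunOn p (Ip p)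

namespace IsPressure

variable {η p : ℝ → ℝ}

lemma pressureInv_mem (hp : IsPressure η p) (y : ℝ) : pressureInv p y ∈ Ip p :=
  Function.invFunOn_mem (hp.surjOn_Ip (mem_univ y))

lemma apply_pressureInv (hp : IsPressure η p) (y : ℝ) : p (pressureInv p y) = y :=
  Function.invFunOn_eq (hp.surjOn_Ip (mem_univ y))

lemma pressureInv_apply (hp : IsPressure η p) {u : ℝ} (hu : u ∈ Ip p) :
    pressureInv p (p u) = u :=
  hp.strictMonoOn_Ip.injOn (hp.pressureInv_mem _) hu (hp.apply_pressureInv _)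

lemma strictMono_pressureInv (hp : IsPressure η p) : StrictMono (pressureInv p) := fun a b hab =>
  (hp.strictMonoOn_Ip.lt_iff_lt (hp.pressureInv_mem a) (hp.pressureInv_mem b)).1
    (by rwa [hp.apply_pressureInv, hp.apply_pressureInv])

lemma continuous_pressureInv (hp : IsPressure η p) : Continuous (pressureInv p) := by
  refine continuous_iff_continuousAt.2 fun y =>
    continuousAt_of_monotoneOn_of_image_mem_nhds
      (hp.strictMono_pressureInv.monotone.monotoneOn univ) univ_mem ?_
  exact mem_of_superset ((isOpen_Ip p).mem_nhds (hp.pressureInv_mem y))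
    fun u hu => ⟨p u, mem_univ _, hp.pressureInv_apply hu⟩

lemma intervalIntegrable (hp : IsPressure η p) {a b : ℝ} (ha : a ∈ closure (Ip p))
    (hb : b ∈ closure (Ip p)) : IntervalIntegrable p volume a b := by
  by_cases h : PressureSingular p
  · rw [Ip_of_singular h, closure_Ioi] at ha hb
    exact (hp.locallyIntegrable.integrableOn_compact_subset
      (ordConnected_Ici.uIcc_subset ha hb) isCompact_uIcc).intervalIntegrable
  · exact (hp.continuous_of_not_singular h).intervalIntegrable a b

lemma integral_sub_const_le (hp : IsPressure η p) {u w : ℝ} (hu : u ∈ Ip p)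
    (hw : w ∈ closure (Ip p)) (e : ℝ) : ∫ a in w..u, (p a - e) ≤ (p u - e) * (u - w) :=
  intervalIntegral_le_mul_sub
    ((hp.intervalIntegrable hw (subset_closure hu)).sub intervalIntegrable_const)
    (fun _ hx => sub_le_sub_right
      (hp.strictMonoOn_Ip.monotoneOn (mem_Ip_of_lt hw hx.1) hu hx.2.le) e)
    (fun _ hx => sub_le_sub_right
      (hp.strictMonoOn_Ip.monotoneOn hu (mem_Ip_of_lt (subset_closure hu) hx.1) hx.1.le) e)

lemma integral_sub_const_adjacent (hp : IsPressure η p) {u v w : ℝ} (hu : u ∈ closure (Ip p))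
    (hv : v ∈ closure (Ip p)) (hw : w ∈ closure (Ip p)) (e : ℝ) :
    (∫ a in u..v, (p a - e)) + ∫ a in v..w, (p a - e) = ∫ a in u..w, (p a - e) :=
  intervalIntegral.integral_add_adjacent_intervals
    ((hp.intervalIntegrable hu hv).sub intervalIntegrable_const)
    ((hp.intervalIntegrable hv hw).sub intervalIntegrable_const)

lemma entropyReal_sub_le (hp : IsPressure η p) {u w : ℝ} (hu : u ∈ Ip p)
    (hw : w ∈ closure (Ip p)) :
    entropyReal p u - entropyReal p w ≤ (p u - p 1) * (u - w) := by
  have hadd := hp.integral_sub_const_adjacent (subset_closure (mem_Ip_of_pos one_pos)) hw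
    (subset_closure hu) (p 1)
  have hle := hp.integral_sub_const_le hu hw (p 1)
  rw [entropyReal, entropyReal]
  linarith

lemma entropyReal_nonneg (hp : IsPressure η p) {w : ℝ} (hw : w ∈ closure (Ip p)) :
    0 ≤ entropyReal p w := by
  have := hp.entropyReal_sub_le (mem_Ip_of_pos one_pos) hw
  rw [entropyReal, intervalIntegral.integral_same] at this
  linarith

-- With `p u₀ = -c`, the product dominates the increment from `w` to `pressureInv p y` of the convex
-- function with derivative `p + c`, which is minimal at `u₀`.
lemma bddBelow_range_pressureInv_sub_mul (hp : IsPressure η p) {w : ℝ}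
    (hw : w ∈ closure (Ip p)) (c : ℝ) :
    BddBelow (range fun y => (pressureInv p y - w) * (y + c)) := by
  set u₀ := pressureInv p (-c)
  have hu₀ : u₀ ∈ Ip p := hp.pressureInv_mem _
  refine ⟨∫ a in w..u₀, (p a - -c), ?_⟩
  rintro _ ⟨y, rfl⟩
  have hy := hp.pressureInv_mem y
  have htangent := hp.integral_sub_const_le hy hw (-c)
  have hmin := hp.integral_sub_const_le hu₀ (subset_closure hy) (-c)
  have hadd := hp.integral_sub_const_adjacent hw (subset_closure hy) (subset_closure hu₀) (-c)
  rw [hp.apply_pressureInv, sub_neg_eq_add] at htangent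
  rw [hp.apply_pressureInv, sub_self, zero_mul] at hmin
  linarith

lemma bddAbove_setOf_pressureInv_sub_mul_le (hp : IsPressure η p) (w c C : ℝ) :
    BddAbove {y | (pressureInv p y - w) * (y + c) ≤ C} := by
  refine bddAbove_setOf_sub_mul_add_le hp.strictMono_pressureInv.monotone
    ⟨p (max w 0 + 1), ?_⟩ c C
  rw [hp.pressureInv_apply (mem_Ip_of_pos (by positivity))]
  exact (le_max_left w 0).trans_lt (lt_add_one _)

lemma bddBelow_setOf_pressureInv_sub_mul_le (hp : IsPressure η p) {w : ℝ} (hw : w ∈ Ip p)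
    (c C : ℝ) : BddBelow {y | (pressureInv p y - w) * (y + c) ≤ C} := by
  obtain ⟨u, hu, huw⟩ := exists_mem_Ip_lt hw
  exact bddBelow_setOf_sub_mul_add_le hp.strictMono_pressureInv.monotone
    ⟨p u, by rwa [hp.pressureInv_apply hu]⟩ c C

end IsPressure

/-! ### Geometry of the simplicial submesh -/

section Geometry

lemma mem_convexHull_image_finset_iff {ι E : Type*} [AddCommGroup E] [Module ℝ E] {N : Finset ι}
    {f : ι → E} {x : E} :
    x ∈ convexHull ℝ (f '' N) ↔
      ∃ w : ι → ℝ, (∀ i ∈ N, 0 ≤ w i) ∧ ∑ i ∈ N, w i = 1 ∧ ∑ i ∈ N, w i • f i = x := by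
  classical
  constructor
  · refine fun hx => convexHull_min (t := {x | ∃ w : ι → ℝ, (∀ i ∈ N, 0 ≤ w i) ∧
      ∑ i ∈ N, w i = 1 ∧ ∑ i ∈ N, w i • f i = x}) ?_ ?_ hx
    · rintro _ ⟨i, hi, rfl⟩
      have hi : i ∈ N := hi
      exact ⟨Pi.single i 1, fun j _ => (Pi.single_nonneg.2 zero_le_one : (0 : ι → ℝ) ≤ _) j,
        by simp [Finset.sum_pi_single', hi], by simp [Pi.single_apply, hi]⟩
    · rintro x ⟨w, hw, hw1, rfl⟩ y ⟨w', hw', hw1', rfl⟩ a b ha hb hab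
      refine ⟨fun i => a * w i + b * w' i, fun i hi => ?_, ?_, ?_⟩
      · exact add_nonneg (mul_nonneg ha (hw i hi)) (mul_nonneg hb (hw' i hi))
      · rw [Finset.sum_add_distrib, ← Finset.mul_sum, ← Finset.mul_sum, hw1, hw1', mul_one,
          mul_one, hab]
      · simp only [add_smul, mul_smul, Finset.sum_add_distrib, Finset.smul_sum]
  · rintro ⟨w, hw, hw1, rfl⟩
    exact (convex_convexHull ℝ _).sum_mem hw hw1
      fun i hi => subset_convexHull ℝ _ (mem_image_of_mem f hi)

lemma exists_mem_frontier_mem_segment {E : Type*} [NormedAddCommGroup E] [NormedSpace ℝ E]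
    {s : Set E} (hs : Bornology.IsBounded s) {x₀ x : E} (hx : x ∈ s) (hne : x ≠ x₀) :
    ∃ y ∈ frontier s, x ∈ segment ℝ x₀ y := by
  let ray : ℝ → E := fun t => x₀ + t • (x - x₀)
  have hray : IsPreconnected (ray '' Ici 1) :=
    isPreconnected_Ici.image ray (by fun_prop)
  obtain ⟨R, hR⟩ := hs.subset_closedBall x₀
  have hpos : 0 < ‖x - x₀‖ := norm_pos_iff.2 (sub_ne_zero.2 hne)
  have hfar : ray (max 1 ((R + 1) / ‖x - x₀‖)) ∉ s := fun hmem => by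
    have hle := mem_closedBall_iff_norm.1 (hR hmem)
    rw [show ∀ t, ray t - x₀ = t • (x - x₀) by simp [ray], norm_smul,
      Real.norm_of_nonneg (zero_le_one.trans (le_max_left _ _)), ← le_div_iff₀ hpos] at hle
    have hlt : (R + 1) / ‖x - x₀‖ ≤ R / ‖x - x₀‖ := (le_max_right _ _).trans hle
    linarith [(div_le_div_iff_of_pos_right hpos).1 hlt]
  obtain ⟨_, ⟨t, ht, rfl⟩, hfr⟩ := inter_frontier_nonempty_of_isPreconnected hray
    ⟨x, ⟨1, self_mem_Ici, by simp [ray]⟩, hx⟩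
    ⟨_, mem_image_of_mem _ (mem_Ici.2 (le_max_left _ _)), hfar⟩
  have ht : 1 ≤ t := ht
  refine ⟨ray t, hfr, ?_⟩
  rw [segment_eq_image']
  refine ⟨t⁻¹, ⟨by positivity, inv_le_one_of_one_le₀ ht⟩, ?_⟩
  simp [ray, smul_smul, inv_mul_cancel₀ (show t ≠ 0 by positivity)]

lemma exists_inner_add_eq_of_affineBasis {ι E : Type*} [Finite ι] [NormedAddCommGroup E]
    [InnerProductSpace ℝ E] [FiniteDimensional ℝ E] (b : AffineBasis ι ℝ E) (f : ι → ℝ) :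
    ∃ (g : E) (c : ℝ), ∀ i, inner ℝ g (b i) + c = f i := by
  classical
  have := Fintype.ofFinite ι
  have := FiniteDimensional.complete ℝ E
  let A : E →ᵃ[ℝ] ℝ := (Fintype.linearCombination ℝ f).toAffineMap.comp b.coords
  have hA : ∀ i, A (b i) = f i := fun i => by
    simp [A, Fintype.linearCombination_apply, b.coord_apply]
  refine ⟨(InnerProductSpace.toDual ℝ E).symm A.linear.toContinuousLinearMap, A 0, fun i => ?_⟩
  rw [InnerProductSpace.toDual_symm_apply, ← hA]
  exact (congrFun A.decomp (b i)).symm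

lemma forall_of_isPreconnected_iUnion {X ι : Type*} [TopologicalSpace X] [Finite ι]
    {c : ι → Set X} (hc : ∀ i, IsClosed (c i)) (hne : ∀ i, (c i).Nonempty)
    (hU : IsPreconnected (⋃ i, c i)) {Q : ι → Prop}
    (hQ : ∀ i j, (c i ∩ c j).Nonempty → Q i → Q j) {i : ι} (hi : Q i) (j : ι) : Q j := by
  by_contra hj
  have hclosed : ∀ A : Set ι, IsClosed (⋃ k ∈ A, c k) := fun A =>
    (toFinite A).isClosed_biUnion fun k _ => hc k
  have meets : ∀ (A : Set ι), ∀ k ∈ A, ((⋃ i, c i) ∩ ⋃ k ∈ A, c k).Nonempty := fun A k hk =>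
    (hne k).mono (subset_inter (subset_iUnion c k) (subset_biUnion_of_mem hk))
  have hcover : ⋃ i, c i ⊆ (⋃ k ∈ {k | Q k}, c k) ∪ ⋃ k ∈ {k | Q k}ᶜ, c k := by
    rw [← biUnion_union, union_compl_self, biUnion_univ]
  obtain ⟨x, -, hx, hx'⟩ := isPreconnected_closed_iff.1 hU _ _ (hclosed _) (hclosed _) hcover
    (meets _ i hi) (meets _ j hj)
  obtain ⟨k, hk, hxk⟩ := mem_iUnion₂.1 hx
  obtain ⟨l, hl, hxl⟩ := mem_iUnion₂.1 hx'
  exact hl (hQ k l ⟨x, hxk, hxl⟩ hk)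

end Geometry

namespace MeshData

variable {d : ℕ} {M F V : Type*} {D : MeshData d M F V} {Ω : Set (Space d)}

lemma mem_hull_iff {N : Finset (M ⊕ F ⊕ V)} {x : Space d} :
    x ∈ D.hull N ↔ ∃ w : M ⊕ F ⊕ V → ℝ, (∀ n ∈ N, 0 ≤ w n) ∧ ∑ n ∈ N, w n = 1 ∧
      ∑ n ∈ N, w n • D.nodePos n = x :=
  mem_convexHull_image_finset_iff

lemma convex_hull (N : Finset (M ⊕ F ⊕ V)) : Convex ℝ (D.hull N) := convex_convexHull ℝ _

variable [DecidableEq V]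

lemma mem_cellVerts_of_mem_faceVerts {T : M × F × Finset V} {s : V} (hT : T ∈ D.submesh)
    (hs : s ∈ D.faceVerts T.2.1) : s ∈ D.cellVerts T.1 :=
  Finset.mem_biUnion.2 ⟨_, hT.1, hs⟩

variable [DecidableEq M] [DecidableEq F]

lemma card_pieceNodes (hd : d = 2 ∨ d = 3) {σ : F} {e : Finset V} (he : e.card = 2) :
    (D.pieceNodes σ e).card = d := by
  have hinj : Function.Injective fun s : V => (Sum.inr (Sum.inr s) : M ⊕ F ⊕ V) :=
    Sum.inr_injective.comp Sum.inr_injective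
  rw [pieceNodes, Finset.card_union_of_disjoint, Finset.card_image_of_injective _ hinj, he]
  · rcases hd with rfl | rfl <;> simp
  · split_ifs <;> simp

lemma card_simplexNodes (hd : d = 2 ∨ d = 3) {T : M × F × Finset V} (he : T.2.2.card = 2) :
    (D.simplexNodes T).card = d + 1 := by
  have hnotMem : Sum.inl T.1 ∉ D.pieceNodes T.2.1 T.2.2 := by
    unfold pieceNodes
    split_ifs <;> simp
  rw [simplexNodes, Finset.card_insert_of_notMem hnotMem, card_pieceNodes hd he]

lemma vertex_mem_simplexNodes {T : M × F × Finset V} {s : V} (hs : s ∈ T.2.2) :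
    Sum.inr (Sum.inr s) ∈ D.simplexNodes T := by
  simp [simplexNodes, pieceNodes, hs]

lemma cell_mem_simplexNodes (T : M × F × Finset V) : Sum.inl T.1 ∈ D.simplexNodes T :=
  Finset.mem_insert_self _ _

lemma eq_or_exists_of_mem_simplexNodes {T : M × F × Finset V} {n : M ⊕ F ⊕ V}
    (hn : n ∈ D.simplexNodes T) :
    n = Sum.inl T.1 ∨ n = Sum.inr (Sum.inl T.2.1) ∨ ∃ s ∈ T.2.2, n = Sum.inr (Sum.inr s) := by
  simp only [simplexNodes, pieceNodes, Finset.mem_insert, Finset.mem_union,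
    Finset.mem_image] at hn
  rcases hn with h | h | ⟨s, hs, rfl⟩
  · exact Or.inl h
  · split_ifs at h
    · exact Or.inr (Or.inl (Finset.mem_singleton.1 h))
    · exact absurd h (Finset.notMem_empty _)
  · exact Or.inr (Or.inr ⟨s, hs, rfl⟩)

lemma volume_hull_pieceNodes (hd : d = 2 ∨ d = 3) {σ : F} {e : Finset V} (he : e.card = 2) :
    volume (D.hull (D.pieceNodes σ e)) = 0 := by
  refine measure_mono_null (convexHull_subset_affineSpan _)
    (Measure.addHaar_affineSubspace volume _ fun htop => ?_)
  obtain ⟨k, rfl⟩ : ∃ k, d = k + 1 := ⟨d - 1, by omega⟩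
  have h := finrank_vectorSpan_image_finset_le ℝ D.nodePos (D.pieceNodes σ e) (n := k)
    (card_pieceNodes hd he)
  rw [← direction_affineSpan, Finset.coe_image, htop, AffineSubspace.direction_top, finrank_top,
    finrank_euclideanSpace_fin] at h
  omega

namespace IsMesh

lemma exists_mem_submesh_of_mem_cellVerts (hD : D.IsMesh Ω) {κ : M} {s : V}
    (hs : s ∈ D.cellVerts κ) : ∃ T ∈ D.submesh, T.1 = κ ∧ s ∈ T.2.2 := by
  obtain ⟨σ, hσ, hsσ⟩ := Finset.mem_biUnion.1 hs
  rw [hD.face_verts] at hsσ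
  obtain ⟨e, he, hse⟩ := Finset.mem_biUnion.1 hsσ
  exact ⟨(κ, σ, e), ⟨hσ, he⟩, rfl, hse⟩

lemma mem_faceVerts_of_mem_edge (hD : D.IsMesh Ω) {T : M × F × Finset V} {s : V}
    (hT : T ∈ D.submesh) (hs : s ∈ T.2.2) : s ∈ D.faceVerts T.2.1 := by
  rw [hD.face_verts]
  exact Finset.mem_biUnion.2 ⟨T.2.2, hT.2, hs⟩

lemma edge_nonempty (hD : D.IsMesh Ω) {T : M × F × Finset V} (hT : T ∈ D.submesh) :
    T.2.2.Nonempty :=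
  Finset.card_pos.1 (by rw [hD.edge_card _ _ hT.2]; exact two_pos)

lemma affineSpan_simplex (hd : d = 2 ∨ d = 3) (hD : D.IsMesh Ω) {T : M × F × Finset V}
    (hT : T ∈ D.submesh) :
    affineSpan ℝ (range fun n : {n // n ∈ D.simplexNodes T} => D.nodePos n) = ⊤ := by
  rw [(hD.simplex_nondegenerate T hT).affineSpan_eq_top_iff_card_eq_finrank_add_one,
    Fintype.card_coe, card_simplexNodes hd (hD.edge_card _ _ hT.2), finrank_euclideanSpace_fin]

lemma interior_hull_nonempty (hd : d = 2 ∨ d = 3) (hD : D.IsMesh Ω) {T : M × F × Finset V}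
    (hT : T ∈ D.submesh) : (interior (D.hull (D.simplexNodes T))).Nonempty := by
  rw [hull, image_eq_range, interior_convexHull_nonempty_iff_affineSpan_eq_top]
  exact hD.affineSpan_simplex hd hT

lemma exists_mem_interior_hull_of_ae (hd : d = 2 ∨ d = 3) (hD : D.IsMesh Ω)
    {T : M × F × Finset V} (hT : T ∈ D.submesh) {P : Space d → Prop}
    (hP : ∀ᵐ x ∂(volume.restrict (D.cell T.1)), P x) :
    ∃ x ∈ interior (D.hull (D.simplexNodes T)), P x := by
  have hcenter : D.cellCenter T.1 ∈ closure (interior (D.hull (D.simplexNodes T))) := by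
    rw [(convex_hull _).closure_interior_eq_closure_of_nonempty_interior
      (hD.interior_hull_nonempty hd hT)]
    exact subset_closure (subset_convexHull ℝ _ ⟨Sum.inl T.1, cell_mem_simplexNodes T, rfl⟩)
  have hpos : 0 < volume (D.cell T.1 ∩ interior (D.hull (D.simplexNodes T))) :=
    ((hD.cell_open T.1).inter isOpen_interior).measure_pos volume
      (mem_closure_iff.1 hcenter _ (hD.cell_open T.1) (hD.center_mem T.1))
  by_contra! hno
  refine hpos.ne' (measure_mono_null (fun x hx => ?_) (ae_iff.1
    ((ae_restrict_iff' (hD.cell_open T.1).measurableSet).1 hP)))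
  exact fun h => hno x hx.2 (h hx.1)

lemma eq_of_sum_smul_nodePos_eq (hD : D.IsMesh Ω) {T : M × F × Finset V} (hT : T ∈ D.submesh)
    {a b : M ⊕ F ⊕ V → ℝ}
    (h1 : ∑ n ∈ D.simplexNodes T, a n = ∑ n ∈ D.simplexNodes T, b n)
    (h2 : ∑ n ∈ D.simplexNodes T, a n • D.nodePos n = ∑ n ∈ D.simplexNodes T, b n • D.nodePos n)
    {n : M ⊕ F ⊕ V} (hn : n ∈ D.simplexNodes T) : a n = b n := by
  have h := affineIndependent_iff.1 (hD.simplex_nondegenerate T hT) Finset.univ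
    (fun n => a n - b n) ?_ ?_ ⟨n, hn⟩ (Finset.mem_univ _)
  · exact sub_eq_zero.1 h
  · rw [Finset.univ_eq_attach, Finset.sum_attach _ fun n => a n - b n, Finset.sum_sub_distrib, h1,
      sub_self]
  · rw [Finset.univ_eq_attach, Finset.sum_attach _ fun n => (a n - b n) • D.nodePos n]
    simp only [sub_smul, Finset.sum_sub_distrib, h2, sub_self]

lemma sum_bary_mul_eq_of_subset (hD : D.IsMesh Ω) {x : Space d} {T : M × F × Finset V}
    {w c : M ⊕ F ⊕ V → ℝ} (h : D.IsBary x T w) {N : Finset (M ⊕ F ⊕ V)}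
    (hN : N ⊆ D.simplexNodes T) (hc : ∑ n ∈ N, c n = 1) (hcx : ∑ n ∈ N, c n • D.nodePos n = x)
    (f : M ⊕ F ⊕ V → ℝ) : ∑ n ∈ D.simplexNodes T, w n * f n = ∑ n ∈ N, c n * f n := by
  obtain ⟨hT, -, hw1, hwx⟩ := h
  have hwc : ∀ n ∈ D.simplexNodes T, w n = if n ∈ N then c n else 0 := fun n =>
    hD.eq_of_sum_smul_nodePos_eq hT (b := fun n => if n ∈ N then c n else 0)
      (by rw [Finset.sum_ite_mem, Finset.inter_eq_right.2 hN, hw1, hc])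
      (by simp only [ite_smul, zero_smul, Finset.sum_ite_mem, Finset.inter_eq_right.2 hN, hwx, hcx])
  rw [Finset.sum_congr rfl fun n hn => by rw [hwc n hn]]
  simp only [ite_mul, zero_mul]
  rw [Finset.sum_ite_mem, Finset.inter_eq_right.2 hN]

lemma sum_bary_mul_eq_sum_bary_mul (hD : D.IsMesh Ω) {x : Space d} {T T' : M × F × Finset V}
    {w w' : M ⊕ F ⊕ V → ℝ} (h : D.IsBary x T w) (h' : D.IsBary x T' w') (f : M ⊕ F ⊕ V → ℝ) :
    ∑ n ∈ D.simplexNodes T, w n * f n = ∑ n ∈ D.simplexNodes T', w' n * f n := by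
  have hx : x ∈ D.hull (D.simplexNodes T ∩ D.simplexNodes T') := by
    rw [← hD.simplex_conforming T h.1 T' h'.1]
    exact ⟨mem_hull_iff.2 ⟨w, h.2⟩, mem_hull_iff.2 ⟨w', h'.2⟩⟩
  obtain ⟨c, -, hc, hcx⟩ := mem_hull_iff.1 hx
  rw [hD.sum_bary_mul_eq_of_subset h Finset.inter_subset_left hc hcx,
    hD.sum_bary_mul_eq_of_subset h' Finset.inter_subset_right hc hcx]

lemma recon_eq_inner_add (hD : D.IsMesh Ω) {T : M × F × Finset V} (hT : T ∈ D.submesh)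
    {v : W M V} {g : Space d} {c : ℝ}
    (hgc : ∀ n ∈ D.simplexNodes T, inner ℝ g (D.nodePos n) + c = D.nodeVal v n) {x : Space d}
    (hx : x ∈ D.hull (D.simplexNodes T)) : D.recon v x = inner ℝ g x + c := by
  obtain ⟨w, hw, hw1, hwx⟩ := mem_hull_iff.1 hx
  have hex : ∃ q : (M × F × Finset V) × (M ⊕ F ⊕ V → ℝ), D.IsBary x q.1 q.2 :=
    ⟨(T, w), hT, hw, hw1, hwx⟩
  calc D.recon v x = ∑ n ∈ D.simplexNodes T, w n * D.nodeVal v n := by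
        rw [recon, dif_pos hex]
        exact hD.sum_bary_mul_eq_sum_bary_mul hex.choose_spec ⟨hT, hw, hw1, hwx⟩ _
    _ = ∑ n ∈ D.simplexNodes T, (inner ℝ g (w n • D.nodePos n) + w n * c) :=
        Finset.sum_congr rfl fun n hn => by rw [← hgc n hn, real_inner_smul_right, mul_add]
    _ = inner ℝ g x + c := by
        rw [Finset.sum_add_distrib, ← inner_sum, hwx, ← Finset.sum_mul, hw1, one_mul]

lemma exists_gradT_eq (hd : d = 2 ∨ d = 3) (hD : D.IsMesh Ω) {T : M × F × Finset V}
    (hT : T ∈ D.submesh) (v : W M V) :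
    ∃ (g : Space d) (c : ℝ),
      (∀ n ∈ D.simplexNodes T, inner ℝ g (D.nodePos n) + c = D.nodeVal v n) ∧
      ∀ x ∈ interior (D.hull (D.simplexNodes T)), D.gradT v x = g := by
  obtain ⟨g, c, hgc⟩ := exists_inner_add_eq_of_affineBasis
    ⟨fun n : {n // n ∈ D.simplexNodes T} => D.nodePos n, hD.simplex_nondegenerate T hT,
      hD.affineSpan_simplex hd hT⟩ fun n => D.nodeVal v n
  have hgc : ∀ n ∈ D.simplexNodes T, inner ℝ g (D.nodePos n) + c = D.nodeVal v n :=
    fun n hn => hgc ⟨n, hn⟩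
  refine ⟨g, c, hgc, fun x hx => HasGradientAt.gradient ?_⟩
  have haffine : HasGradientAt (fun y => inner ℝ g y + c) g x :=
    ((InnerProductSpace.toDual ℝ (Space d) g).hasFDerivAt (x := x)).add_const c
  refine haffine.congr_of_eventuallyEq ?_
  filter_upwards [mem_interior_iff_mem_nhds.1 hx] with y hy using hD.recon_eq_inner_add hT hgc hy

lemma exists_mem_hull_of_mem_segment (hD : D.IsMesh Ω) {κ : M} {x y : Space d}
    (hy : y ∈ frontier (D.cell κ)) (hx : x ∈ segment ℝ (D.cellCenter κ) y) :
    ∃ T ∈ D.submesh, T.1 = κ ∧ x ∈ D.hull (D.simplexNodes T) := by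
  rw [hD.cell_frontier] at hy
  obtain ⟨σ, hσ, hy⟩ := mem_iUnion₂.1 hy
  obtain ⟨e, he, hy⟩ := mem_iUnion₂.1 hy
  exact ⟨(κ, σ, e), ⟨hσ, he⟩, rfl, (convex_hull _).segment_subset
    (subset_convexHull ℝ _ ⟨Sum.inl κ, cell_mem_simplexNodes (κ, σ, e), rfl⟩)
    (convexHull_mono (image_mono (Finset.subset_insert _ _)) hy) hx⟩

lemma frontier_cell_nonempty (hd : d = 2 ∨ d = 3) (hD : D.IsMesh Ω) (hΩ : Bornology.IsBounded Ω)
    (κ : M) : (frontier (D.cell κ)).Nonempty := by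
  have : Nonempty (Fin d) := ⟨⟨0, by omega⟩⟩
  rw [nonempty_frontier_iff]
  refine ⟨⟨_, hD.center_mem κ⟩, fun h => ?_⟩
  exact NormedSpace.unbounded_univ ℝ (Space d) (h ▸ hΩ.subset (hD.cell_subset κ))

lemma exists_mem_hull_of_mem_closure (hd : d = 2 ∨ d = 3) (hD : D.IsMesh Ω)
    (hΩ : Bornology.IsBounded Ω) {κ : M} {x : Space d} (hx : x ∈ closure (D.cell κ)) :
    ∃ T ∈ D.submesh, T.1 = κ ∧ x ∈ D.hull (D.simplexNodes T) := by
  rw [closure_eq_self_union_frontier] at hx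
  rcases hx with hx | hx
  · by_cases hne : x = D.cellCenter κ
    · obtain ⟨y, hy⟩ := hD.frontier_cell_nonempty hd hΩ κ
      exact hD.exists_mem_hull_of_mem_segment hy (hne ▸ left_mem_segment ℝ _ _)
    · obtain ⟨y, hy, hxy⟩ :=
        exists_mem_frontier_mem_segment (hΩ.subset (hD.cell_subset κ)) hx hne
      exact hD.exists_mem_hull_of_mem_segment hy hxy
  · exact hD.exists_mem_hull_of_mem_segment hx (right_mem_segment ℝ _ _)

lemma exists_common_vertex (hd : d = 2 ∨ d = 3) (hD : D.IsMesh Ω) (hΩ : Bornology.IsBounded Ω)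
    {κ κ' : M} (hne : κ ≠ κ') (h : (closure (D.cell κ) ∩ closure (D.cell κ')).Nonempty) :
    ∃ s, s ∈ D.cellVerts κ ∧ s ∈ D.cellVerts κ' := by
  obtain ⟨x, hx, hx'⟩ := h
  obtain ⟨T, hT, rfl, hxT⟩ := hD.exists_mem_hull_of_mem_closure hd hΩ hx
  obtain ⟨T', hT', rfl, hxT'⟩ := hD.exists_mem_hull_of_mem_closure hd hΩ hx'
  have hxinter : x ∈ D.hull (D.simplexNodes T ∩ D.simplexNodes T') :=
    hD.simplex_conforming T hT T' hT' ▸ ⟨hxT, hxT'⟩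
  obtain ⟨_, n, hn, -⟩ := convexHull_nonempty_iff.1 ⟨x, hxinter⟩
  obtain ⟨hn, hn'⟩ := Finset.mem_inter.1 hn
  rcases eq_or_exists_of_mem_simplexNodes hn with rfl | rfl | ⟨s, hs, rfl⟩ <;>
    rcases eq_or_exists_of_mem_simplexNodes hn' with h | h | ⟨s', hs', h⟩ <;>
    simp only [Sum.inl.injEq, Sum.inr.injEq, reduceCtorEq] at h
  · exact absurd h hne
  · obtain ⟨s, hs⟩ := hD.edge_nonempty hT
    have hsf := hD.mem_faceVerts_of_mem_edge hT hs
    exact ⟨s, mem_cellVerts_of_mem_faceVerts hT hsf,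
      mem_cellVerts_of_mem_faceVerts hT' (h ▸ hsf)⟩
  · exact ⟨s, mem_cellVerts_of_mem_faceVerts hT (hD.mem_faceVerts_of_mem_edge hT hs),
      mem_cellVerts_of_mem_faceVerts hT' (hD.mem_faceVerts_of_mem_edge hT' (h ▸ hs'))⟩

lemma forall_of_propagates [Finite M] (hd : d = 2 ∨ d = 3) (hD : D.IsMesh Ω)
    (hΩ : Bornology.IsBounded Ω) (hΩc : IsPreconnected Ω) {Q : M ⊕ V → Prop}
    (hcv : ∀ κ, ∀ s ∈ D.cellVerts κ, Q (Sum.inl κ) → Q (Sum.inr s))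
    (hvc : ∀ κ, ∀ s ∈ D.cellVerts κ, Q (Sum.inr s) → Q (Sum.inl κ)) (hQ : ∃ b, Q b) :
    ∀ b, Q b := by
  obtain ⟨κ₀, hκ₀⟩ : ∃ κ, Q (Sum.inl κ) := by
    obtain ⟨κ | s, hb⟩ := hQ
    · exact ⟨κ, hb⟩
    · obtain ⟨κ, hκ⟩ := hD.vertex_cell s
      exact ⟨κ, hvc κ s hκ hb⟩
  have hcells : ∀ κ, Q (Sum.inl κ) := by
    refine forall_of_isPreconnected_iUnion (c := fun κ => closure (D.cell κ))
      (Q := fun κ => Q (Sum.inl κ)) (fun _ => isClosed_closure)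
      (fun κ => ⟨_, subset_closure (hD.center_mem κ)⟩) (hD.cell_cover ▸ hΩc.closure)
      (fun κ κ' hinter hκ => ?_) hκ₀
    rcases eq_or_ne κ κ' with rfl | hne
    · exact hκ
    · obtain ⟨s, hs, hs'⟩ := hD.exists_common_vertex hd hΩ hne hinter
      exact hvc κ' s hs' (hcv κ s hs hκ)
  rintro (κ | s)
  · exact hcells κ
  · obtain ⟨κ, hκ⟩ := hD.vertex_cell s
    exact hcv κ s hκ (hcells κ)

lemma volume_frontier_cell (hd : d = 2 ∨ d = 3) (hD : D.IsMesh Ω) (κ : M) :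
    volume (frontier (D.cell κ)) = 0 := by
  rw [hD.cell_frontier]
  refine (measure_biUnion_null_iff (D.cellFaces κ).countable_toSet).2 fun σ _ => ?_
  refine (measure_biUnion_null_iff (D.faceEdges σ).countable_toSet).2 fun e he => ?_
  exact volume_hull_pieceNodes hd (hD.edge_card σ e he)

lemma ae_exists_mem_interior_hull [Finite M] [Finite F] [Finite V] (hd : d = 2 ∨ d = 3)
    (hD : D.IsMesh Ω) (hΩ : Bornology.IsBounded Ω) (κ : M) :
    ∀ᵐ x ∂(volume.restrict (D.cell κ)),
      ∃ T ∈ D.submesh, T.1 = κ ∧ x ∈ interior (D.hull (D.simplexNodes T)) := by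
  have hfr : ∀ᵐ x ∂(volume : Measure (Space d)), ∀ T : M × F × Finset V,
      x ∉ frontier (D.hull (D.simplexNodes T)) :=
    ae_all_iff.2 fun T => measure_eq_zero_iff_ae_notMem.1 ((convex_hull _).addHaar_frontier volume)
  filter_upwards [ae_restrict_mem (hD.cell_open κ).measurableSet, ae_restrict_of_ae hfr] with x hx h
  obtain ⟨T, hT, hTκ, hxT⟩ := hD.exists_mem_hull_of_mem_closure hd hΩ (subset_closure hx)
  exact ⟨T, hT, hTκ, by_contra fun hni => h T ⟨subset_closure hxT, hni⟩⟩

end IsMesh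

end MeshData

/-! ### Positive definiteness of the local matrices -/

section QuadraticForms

lemma abs_inner_apply_le_of_symmetric {E : Type*} [NormedAddCommGroup E] [InnerProductSpace ℝ E]
    {T : E →L[ℝ] E} {C : ℝ} (hT : ∀ v w, inner ℝ (T v) w = inner ℝ v (T w))
    (h0 : ∀ v, 0 ≤ inner ℝ (T v) v) (hC : ∀ v, inner ℝ (T v) v ≤ C * ‖v‖ ^ 2) (a b : E) :
    |inner ℝ (T a) b| ≤ C * (‖a‖ ^ 2 + ‖b‖ ^ 2) / 2 := by
  have hab : inner ℝ (T b) a = inner ℝ (T a) b := by rw [hT, real_inner_comm]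
  have hpolar : 4 * inner ℝ (T a) b
      = inner ℝ (T (a + b)) (a + b) - inner ℝ (T (a - b)) (a - b) := by
    simp only [map_add, map_sub, inner_add_left, inner_add_right, inner_sub_left,
      inner_sub_right, hab]
    ring
  have hsum : C * ‖a + b‖ ^ 2 + C * ‖a - b‖ ^ 2 = 2 * (C * (‖a‖ ^ 2 + ‖b‖ ^ 2)) := by
    linear_combination C * parallelogram_law_with_norm ℝ a b
  rw [abs_le]
  constructor <;> linarith [h0 (a + b), h0 (a - b), hC (a + b), hC (a - b)]

lemma exists_pos_forall_mul_sq_le_dotProduct_mulVec {ι : Type*} [Fintype ι] (A : Matrix ι ι ℝ)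
    (hA : ∀ w : ι → ℝ, w ≠ 0 → 0 < w ⬝ᵥ (A *ᵥ w)) :
    ∃ c > 0, ∀ (w : ι → ℝ) (i : ι), c * w i ^ 2 ≤ w ⬝ᵥ (A *ᵥ w) := by
  have hcont : Continuous fun w : ι → ℝ => w ⬝ᵥ (A *ᵥ w) := by
    simp only [dotProduct, Matrix.mulVec]
    fun_prop
  obtain ⟨c, hc, hmin⟩ : ∃ c > 0, ∀ w ∈ Metric.sphere (0 : ι → ℝ) 1, c ≤ w ⬝ᵥ (A *ᵥ w) := by
    rcases (Metric.sphere (0 : ι → ℝ) 1).eq_empty_or_nonempty with h | h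
    · exact ⟨1, one_pos, by simp [h]⟩
    · obtain ⟨w₀, hw₀, hm⟩ := (isCompact_sphere (0 : ι → ℝ) 1).exists_isMinOn h hcont.continuousOn
      exact ⟨_, hA w₀ (ne_zero_of_mem_unit_sphere ⟨w₀, hw₀⟩), fun w hw => hm hw⟩
  refine ⟨c, hc, fun w i => ?_⟩
  rcases eq_or_ne w 0 with rfl | hw
  · simp
  have hn : 0 < ‖w‖ := norm_pos_iff.2 hw
  have hunit := hmin (‖w‖⁻¹ • w) (by simp [norm_smul, hn.ne'])
  rw [Matrix.mulVec_smul, smul_dotProduct, dotProduct_smul, smul_eq_mul, smul_eq_mul] at hunit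
  calc c * w i ^ 2 ≤ c * ‖w‖ ^ 2 := by
        refine mul_le_mul_of_nonneg_left ?_ hc.le
        exact sq_le_sq.2 ((norm_le_pi_norm w i).trans_eq (abs_norm w).symm)
    _ ≤ (‖w‖⁻¹ * (‖w‖⁻¹ * w ⬝ᵥ (A *ᵥ w))) * ‖w‖ ^ 2 := by gcongr
    _ = w ⬝ᵥ (A *ᵥ w) := by field_simp

end QuadraticForms

lemma IsPermeability.mono {d : ℕ} {Ω Ω' : Set (Space d)} {L : Space d → Space d →L[ℝ] Space d}
    (hL : IsPermeability Ω L) (h : Ω' ⊆ Ω) : IsPermeability Ω' L := by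
  have hle : volume.restrict Ω' ≤ volume.restrict Ω := Measure.restrict_mono h le_rfl
  obtain ⟨lmin, lmax, hmin, hmax, hell⟩ := hL.elliptic
  exact ⟨hL.measurable.mono_measure hle, ae_mono hle hL.symm, lmin, lmax, hmin, hmax,
    ae_mono hle hell⟩

namespace MeshData

variable {d : ℕ} {M F V : Type*} [DecidableEq M] [DecidableEq F] [DecidableEq V]

/-- The gradient `∇π_T (∑ w_s e_s)` of the finite element function with the values `w` at the
vertices of the cell `κ` and `0` at the other nodes, written as a combination of the basis
gradients so as to be linear in `w` at every point. -/
noncomputable def localGrad (D : MeshData d M F V) (κ : M) (w : {s // s ∈ D.cellVerts κ} → ℝ)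
    (x : Space d) : Space d :=
  ∑ s, w s • D.gradT (basisVertex s.1) x

variable {D : MeshData d M F V} {Ω : Set (Space d)} {L : Space d → Space d →L[ℝ] Space d} {κ : M}

lemma measurable_gradT (v : W M V) : Measurable (D.gradT v) :=
  (InnerProductSpace.toDual ℝ (Space d)).symm.continuous.measurable.comp
    (measurable_fderiv ℝ (D.recon v))

lemma inner_localGrad_eq_sum (w : {s // s ∈ D.cellVerts κ} → ℝ) (x : Space d) :
    inner ℝ (L x (D.localGrad κ w x)) (D.localGrad κ w x) = ∑ s, ∑ s', w s * (w s' *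
      inner ℝ (L x (D.gradT (basisVertex s.1) x)) (D.gradT (basisVertex s'.1) x)) := by
  simp only [localGrad, map_sum, map_smul, sum_inner, inner_sum, real_inner_smul_left,
    real_inner_smul_right]
  rw [Finset.sum_comm]
  exact Finset.sum_congr rfl fun s _ => Finset.sum_congr rfl fun s' _ => by ring

namespace IsMesh

lemma eq_zero_of_localGrad_eq_zero (hd : d = 2 ∨ d = 3) (hD : D.IsMesh Ω)
    {T : M × F × Finset V} (hT : T ∈ D.submesh) {x : Space d}
    (hx : x ∈ interior (D.hull (D.simplexNodes T))) {w : {s // s ∈ D.cellVerts T.1} → ℝ}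
    (hw : D.localGrad T.1 w x = 0) {s : {s // s ∈ D.cellVerts T.1}} (hs : s.1 ∈ T.2.2) :
    w s = 0 := by
  choose g c hgc hgrad using fun s : {s // s ∈ D.cellVerts T.1} =>
    hD.exists_gradT_eq hd hT (basisVertex (M := M) s.1)
  have hsum : ∑ s, w s • g s = 0 := by
    rw [← hw, localGrad]
    exact Finset.sum_congr rfl fun s _ => by rw [hgrad s x hx]
  have hconst : ∀ n ∈ D.simplexNodes T,
      ∑ s, w s * D.nodeVal (basisVertex s.1) n = ∑ s, w s * c s := fun n hn => by
    have hlin : ∑ s, w s * inner ℝ (g s) (D.nodePos n) = 0 := by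
      simp only [← real_inner_smul_left, ← sum_inner, hsum, inner_zero_left]
    simp only [← hgc _ n hn, mul_add, Finset.sum_add_distrib, hlin, zero_add]
  have hcenter : ∑ s, w s * D.nodeVal (basisVertex s.1) (Sum.inl T.1) = 0 := by
    simp [nodeVal, basisVertex]
  have hvertex : ∑ s', w s' * D.nodeVal (basisVertex s'.1) (Sum.inr (Sum.inr s.1)) = w s := by
    rw [Finset.sum_eq_single s]
    · simp [nodeVal, basisVertex]
    · intro s' _ hne
      simp [nodeVal, basisVertex, Subtype.coe_ne_coe.2 hne.symm]
    · exact fun h => absurd (Finset.mem_univ _) h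
  rw [← hvertex, hconst _ (vertex_mem_simplexNodes hs), ← hconst _ (cell_mem_simplexNodes T),
    hcenter]

lemma eq_zero_of_ae_localGrad_eq_zero (hd : d = 2 ∨ d = 3) (hD : D.IsMesh Ω)
    {w : {s // s ∈ D.cellVerts κ} → ℝ}
    (hw : ∀ᵐ x ∂(volume.restrict (D.cell κ)), D.localGrad κ w x = 0) : w = 0 := by
  funext s
  obtain ⟨T, hT, rfl, hsT⟩ := hD.exists_mem_submesh_of_mem_cellVerts s.2
  obtain ⟨x, hx, hwx⟩ := hD.exists_mem_interior_hull_of_ae hd hT hw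
  exact hD.eq_zero_of_localGrad_eq_zero hd hT hx hwx hsT

variable [Finite M] [Finite F] [Finite V]

lemma exists_ae_norm_gradT_le (hd : d = 2 ∨ d = 3) (hD : D.IsMesh Ω) (hΩ : Bornology.IsBounded Ω)
    (κ : M) (v : W M V) : ∃ C, ∀ᵐ x ∂(volume.restrict (D.cell κ)), ‖D.gradT v x‖ ≤ C := by
  choose! g c _ hg using fun (T) (hT : T ∈ D.submesh) => hD.exists_gradT_eq hd hT v
  obtain ⟨C, hC⟩ := (finite_range fun T => ‖g T‖).bddAbove
  refine ⟨C, ?_⟩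
  filter_upwards [hD.ae_exists_mem_interior_hull hd hΩ κ] with x hx
  obtain ⟨T, hT, -, hx⟩ := hx
  rw [hg T hT x hx]
  exact hC (mem_range_self T)

lemma integrableOn_inner_gradT (hd : d = 2 ∨ d = 3) (hD : D.IsMesh Ω)
    (hΩ : Bornology.IsBounded Ω) (hL : IsPermeability Ω L) (κ : M) (v v' : W M V) :
    IntegrableOn (fun x => inner ℝ (L x (D.gradT v x)) (D.gradT v' x)) (D.cell κ) := by
  have hLκ := hL.mono (hD.cell_subset κ)
  obtain ⟨C, hC⟩ := hD.exists_ae_norm_gradT_le hd hΩ κ v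
  obtain ⟨C', hC'⟩ := hD.exists_ae_norm_gradT_le hd hΩ κ v'
  obtain ⟨lmin, lmax, hmin, hle, hell⟩ := hLκ.elliptic
  have : IsFiniteMeasure (volume.restrict (D.cell κ)) :=
    isFiniteMeasure_restrict.2 (hΩ.subset (hD.cell_subset κ)).measure_lt_top.ne
  refine Integrable.of_bound (C := lmax * (C ^ 2 + C' ^ 2) / 2) ?_ ?_
  · have happly : AEStronglyMeasurable (fun x => L x (D.gradT v x))
        (volume.restrict (D.cell κ)) :=
      (ContinuousLinearMap.id ℝ (Space d →L[ℝ] Space d)).aestronglyMeasurable_comp₂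
        hLκ.measurable (measurable_gradT v).aestronglyMeasurable
    exact happly.inner (measurable_gradT v').aestronglyMeasurable
  · filter_upwards [hC, hC', hell, hLκ.symm] with x hv hv' hx hsymm
    have hlmax : 0 ≤ lmax := hmin.le.trans hle
    refine (abs_inner_apply_le_of_symmetric hsymm (fun v => le_trans (by positivity) (hx v).1)
      (fun v => (hx v).2) _ _).trans ?_
    gcongr

lemma integrableOn_inner_localGrad (hd : d = 2 ∨ d = 3) (hD : D.IsMesh Ω)
    (hΩ : Bornology.IsBounded Ω) (hL : IsPermeability Ω L) (w : {s // s ∈ D.cellVerts κ} → ℝ) :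
    IntegrableOn (fun x => inner ℝ (L x (D.localGrad κ w x)) (D.localGrad κ w x)) (D.cell κ) := by
  simp only [inner_localGrad_eq_sum]
  exact integrable_finsetSum _ fun s _ => integrable_finsetSum _ fun s' _ =>
    ((hD.integrableOn_inner_gradT hd hΩ hL κ _ _).const_mul _).const_mul _

lemma dotProduct_matA_mulVec (hd : d = 2 ∨ d = 3) (hD : D.IsMesh Ω)
    (hΩ : Bornology.IsBounded Ω) (hL : IsPermeability Ω L) (w : {s // s ∈ D.cellVerts κ} → ℝ) :
    w ⬝ᵥ (D.matA L κ *ᵥ w) =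
      ∫ x in D.cell κ, inner ℝ (L x (D.localGrad κ w x)) (D.localGrad κ w x) := by
  have hterm : ∀ s s' : {s // s ∈ D.cellVerts κ}, IntegrableOn (fun x => w s * (w s' *
      inner ℝ (L x (D.gradT (basisVertex s.1) x)) (D.gradT (basisVertex s'.1) x))) (D.cell κ) :=
    fun s s' => ((hD.integrableOn_inner_gradT hd hΩ hL κ _ _).const_mul _).const_mul _
  simp only [inner_localGrad_eq_sum]
  rw [integral_finsetSum _ fun s _ => integrable_finsetSum _ fun s' _ => hterm s s']
  simp_rw [integral_finsetSum _ fun s' _ => hterm _ s', integral_const_mul]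
  simp only [dotProduct, Matrix.mulVec, matA, Matrix.of_apply, Finset.mul_sum]
  exact Finset.sum_congr rfl fun s _ => Finset.sum_congr rfl fun s' _ => by ring

lemma dotProduct_matA_mulVec_pos (hd : d = 2 ∨ d = 3) (hD : D.IsMesh Ω)
    (hΩ : Bornology.IsBounded Ω) (hL : IsPermeability Ω L) {w : {s // s ∈ D.cellVerts κ} → ℝ}
    (hw : w ≠ 0) : 0 < w ⬝ᵥ (D.matA L κ *ᵥ w) := by
  rw [hD.dotProduct_matA_mulVec hd hΩ hL]
  obtain ⟨lmin, lmax, hmin, -, hell⟩ := (hL.mono (hD.cell_subset κ)).elliptic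
  have hlow : ∀ᵐ x ∂(volume.restrict (D.cell κ)), lmin * ‖D.localGrad κ w x‖ ^ 2 ≤
      inner ℝ (L x (D.localGrad κ w x)) (D.localGrad κ w x) := by
    filter_upwards [hell] with x hx using (hx _).1
  have hnonneg : 0 ≤ᵐ[volume.restrict (D.cell κ)]
      fun x => inner ℝ (L x (D.localGrad κ w x)) (D.localGrad κ w x) := by
    filter_upwards [hlow] with x hx using le_trans (by positivity) hx
  refine (integral_nonneg_of_ae hnonneg).lt_of_ne fun h0 =>
    hw (hD.eq_zero_of_ae_localGrad_eq_zero hd ?_)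
  filter_upwards [hlow, (setIntegral_eq_zero_iff_of_nonneg_ae hnonneg
    (hD.integrableOn_inner_localGrad hd hΩ hL w)).1 h0.symm] with x hx hx0
  rw [hx0, Pi.zero_apply] at hx
  have hsq : ‖D.localGrad κ w x‖ ^ 2 = 0 :=
    le_antisymm (nonpos_of_mul_nonpos_right hx hmin) (by positivity)
  simpa using hsq

lemma dotProduct_matA_mulVec_nonneg (hd : d = 2 ∨ d = 3) (hD : D.IsMesh Ω)
    (hΩ : Bornology.IsBounded Ω) (hL : IsPermeability Ω L) (w : {s // s ∈ D.cellVerts κ} → ℝ) :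
    0 ≤ w ⬝ᵥ (D.matA L κ *ᵥ w) := by
  rcases eq_or_ne w 0 with rfl | hw
  · simp
  · exact (hD.dotProduct_matA_mulVec_pos hd hΩ hL hw).le

end IsMesh

end MeshData

/-! ### Integrals of piecewise constant reconstructions -/

namespace Lumping

variable {d : ℕ} {M F V : Type*} [Fintype M] [DecidableEq V] {D : MeshData d M F V}
  {P : Lumping d M V} {Ω : Set (Space d)}

/-- The sets `ω_κ` and `ω_s` on which `π_D` is constant, as one family indexed by `M ⊕ V`, the index
set of the components of the vectors of `W_D`. -/
def omega (P : Lumping d M V) (D : MeshData d M F V) : M ⊕ V → Set (Space d) :=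
  Sum.elim P.omegaCell (P.omegaVertex D)

lemma mem_omegaVertex {s : V} {x : Space d} :
    x ∈ P.omegaVertex D s ↔ ∃ κ, s ∈ D.cellVerts κ ∧ x ∈ P.omegaCV κ s := by
  simp [omegaVertex, MeshData.vertexCells]

lemma reconD_eq_sum_indicator_omega [Fintype V] (v : W M V) (x : Space d) :
    P.reconD D v x = ∑ b, (P.omega D b).indicator (fun _ => v b) x := by
  rw [Fintype.sum_sum_type]
  rfl

namespace IsLumping

lemma isOpen_omega (hP : P.IsLumping D) (b : M ⊕ V) : IsOpen (P.omega D b) := by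
  rcases b with κ | s
  · exact hP.omegaCell_open κ
  · refine isOpen_biUnion fun κ hκ => hP.omegaCV_open κ s ?_
    simpa [MeshData.vertexCells] using hκ

lemma exists_cell_of_mem_omega (hP : P.IsLumping D) {b : M ⊕ V} {x : Space d}
    (hx : x ∈ P.omega D b) :
    ∃ κ, x ∈ D.cell κ ∧ ((b = Sum.inl κ ∧ x ∈ P.omegaCell κ) ∨
      ∃ s ∈ D.cellVerts κ, b = Sum.inr s ∧ x ∈ P.omegaCV κ s) := by
  rcases b with κ | s
  · exact ⟨κ, hP.omegaCell_subset κ hx, Or.inl ⟨rfl, hx⟩⟩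
  · obtain ⟨κ, hs, hxκ⟩ := mem_omegaVertex.1 hx
    exact ⟨κ, hP.omegaCV_subset κ s hs hxκ, Or.inr ⟨s, hs, rfl, hxκ⟩⟩

variable [DecidableEq M] [DecidableEq F]

lemma pairwise_disjoint_omega (hP : P.IsLumping D) (hD : D.IsMesh Ω) :
    Pairwise fun b b' => Disjoint (P.omega D b) (P.omega D b') := by
  intro b b' hne
  rw [Set.disjoint_left]
  intro x hx hx'
  obtain ⟨κ, hκ, h⟩ := hP.exists_cell_of_mem_omega hx
  obtain ⟨κ', hκ', h'⟩ := hP.exists_cell_of_mem_omega hx'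
  obtain rfl : κ = κ' := by
    by_contra hcon
    exact Set.disjoint_left.1 (hD.cell_disjoint hcon) hκ hκ'
  rcases h with ⟨rfl, h⟩ | ⟨s, hs, rfl, h⟩ <;> rcases h' with ⟨rfl, h'⟩ | ⟨s', hs', rfl, h'⟩
  · exact hne rfl
  · exact Set.disjoint_left.1 (hP.disjoint_cell κ s' hs') h h'
  · exact Set.disjoint_left.1 (hP.disjoint_cell κ s hs) h' h
  · exact Set.disjoint_left.1 (hP.disjoint_cv κ s hs s' hs' fun h => hne (by rw [h])) h h'

lemma omega_subset (hP : P.IsLumping D) (hD : D.IsMesh Ω) (b : M ⊕ V) : P.omega D b ⊆ Ω := by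
  intro x hx
  obtain ⟨κ, hκ, -⟩ := hP.exists_cell_of_mem_omega hx
  exact hD.cell_subset κ hκ

lemma volume_omega_ne_top (hP : P.IsLumping D) (hD : D.IsMesh Ω) (hΩ : Bornology.IsBounded Ω)
    (b : M ⊕ V) : volume (P.omega D b) ≠ ∞ :=
  (hΩ.subset (hP.omega_subset hD b)).measure_lt_top.ne

lemma volume_real_omega (hP : P.IsLumping D) (hD : D.IsMesh Ω) (hΩ : Bornology.IsBounded Ω)
    (b : M ⊕ V) : volume.real (P.omega D b) = P.mass D b := by
  rcases b with κ | s
  · exact hP.meas_cell κ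
  · have hmem : ∀ κ ∈ D.vertexCells s, s ∈ D.cellVerts κ := fun κ hκ => by
      simpa [MeshData.vertexCells] using hκ
    have hsub : ∀ κ ∈ D.vertexCells s, P.omegaCV κ s ⊆ D.cell κ := fun κ hκ =>
      hP.omegaCV_subset κ s (hmem κ hκ)
    change volume.real (⋃ κ ∈ D.vertexCells s, P.omegaCV κ s)
      = ∑ κ ∈ D.vertexCells s, P.massCV D κ s
    rw [measureReal_biUnion_finset
      (fun κ hκ κ' hκ' hne => (hD.cell_disjoint hne).mono (hsub κ hκ) (hsub κ' hκ'))
      (fun κ hκ => (hP.omegaCV_open κ s (hmem κ hκ)).measurableSet)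
      (fun κ hκ => (hΩ.subset ((hsub κ hκ).trans (hD.cell_subset κ))).measure_lt_top.ne)]
    exact Finset.sum_congr rfl fun κ hκ => hP.meas_cv κ s (hmem κ hκ)

lemma volume_omega (hP : P.IsLumping D) (hD : D.IsMesh Ω) (hΩ : Bornology.IsBounded Ω)
    (b : M ⊕ V) : volume (P.omega D b) = ENNReal.ofReal (P.mass D b) := by
  rw [← hP.volume_real_omega hD hΩ, ofReal_measureReal (hP.volume_omega_ne_top hD hΩ b)]

lemma volume_real_omegaCell_union (hP : P.IsLumping D) (hD : D.IsMesh Ω)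
    (hΩ : Bornology.IsBounded Ω) (κ : M) :
    volume.real (P.omegaCell κ ∪ ⋃ s ∈ D.cellVerts κ, P.omegaCV κ s)
      = volume.real (D.cell κ) := by
  have hfin : ∀ A ⊆ D.cell κ, volume A ≠ ∞ := fun A hA =>
    (hΩ.subset (hA.trans (hD.cell_subset κ))).measure_lt_top.ne
  have hvertices : volume.real (⋃ s ∈ D.cellVerts κ, P.omegaCV κ s)
      = ∑ s ∈ D.cellVerts κ, P.massCV D κ s := by
    rw [measureReal_biUnion_finset (fun s hs s' hs' hne => hP.disjoint_cv κ s hs s' hs' hne)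
      (fun s hs => (hP.omegaCV_open κ s hs).measurableSet)
      (fun s hs => hfin _ (hP.omegaCV_subset κ s hs))]
    exact Finset.sum_congr rfl fun s hs => hP.meas_cv κ s hs
  have hmeas : MeasurableSet (⋃ s ∈ D.cellVerts κ, P.omegaCV κ s) :=
    (isOpen_biUnion fun s hs => hP.omegaCV_open κ s hs).measurableSet
  rw [measureReal_union (by simpa only [disjoint_iUnion_right] using hP.disjoint_cell κ) hmeas
    (hfin _ (hP.omegaCell_subset κ)) (hfin _ (iUnion₂_subset (hP.omegaCV_subset κ))),
    hP.meas_cell κ, hvertices]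
  simp [mass]

lemma volume_cell_sdiff_iUnion_omega (hP : P.IsLumping D) (hD : D.IsMesh Ω)
    (hΩ : Bornology.IsBounded Ω) (κ : M) : volume (D.cell κ \ ⋃ b, P.omega D b) = 0 := by
  set S := P.omegaCell κ ∪ ⋃ s ∈ D.cellVerts κ, P.omegaCV κ s with hS
  have hSκ : S ⊆ D.cell κ :=
    union_subset (hP.omegaCell_subset κ) (iUnion₂_subset (hP.omegaCV_subset κ))
  have hSm : MeasurableSet S := ((hP.omegaCell_open κ).union
    (isOpen_biUnion fun s hs => hP.omegaCV_open κ s hs)).measurableSet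
  have hSω : S ⊆ ⋃ b, P.omega D b :=
    union_subset (subset_iUnion (P.omega D) (Sum.inl κ)) (iUnion₂_subset fun s hs =>
      subset_iUnion_of_subset (Sum.inr s) fun x hx => mem_omegaVertex.2 ⟨κ, hs, hx⟩)
  have hfin : volume (D.cell κ) ≠ ∞ := (hΩ.subset (hD.cell_subset κ)).measure_lt_top.ne
  have hdiff := measureReal_sdiff (μ := volume) hSκ hSm hfin
  rw [hS, hP.volume_real_omegaCell_union hD hΩ, sub_self,
    measureReal_eq_zero_iff (measure_ne_top_of_subset sdiff_subset hfin)] at hdiff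
  exact measure_mono_null (sdiff_subset_sdiff_right hSω) hdiff

lemma iUnion_omega_ae_eq (hP : P.IsLumping D) (hd : d = 2 ∨ d = 3) (hD : D.IsMesh Ω)
    (hΩ : Bornology.IsBounded Ω) : (⋃ b, P.omega D b) =ᵐ[volume] Ω := by
  have hcover : Ω \ ⋃ b, P.omega D b ⊆
      ⋃ κ, (D.cell κ \ ⋃ b, P.omega D b) ∪ frontier (D.cell κ) := by
    rintro x ⟨hx, hxω⟩
    obtain ⟨κ, hκ⟩ := mem_iUnion.1 (hD.cell_cover ▸ subset_closure hx)
    rw [closure_eq_self_union_frontier] at hκ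
    exact mem_iUnion.2 ⟨κ, hκ.imp_left fun h => ⟨h, hxω⟩⟩
  refine (iUnion_subset (hP.omega_subset hD)).eventuallyLE.antisymm
    (ae_le_set.2 (measure_mono_null hcover ?_))
  exact measure_iUnion_null fun κ => measure_union_null
    (hP.volume_cell_sdiff_iUnion_omega hD hΩ κ) (hD.volume_frontier_cell hd κ)

variable [Fintype V]

lemma reconD_of_mem_omega (hP : P.IsLumping D) (hD : D.IsMesh Ω) (v : W M V) {b : M ⊕ V}
    {x : Space d} (hx : x ∈ P.omega D b) : P.reconD D v x = v b := by
  rw [reconD_eq_sum_indicator_omega, Finset.sum_eq_single b]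
  · exact indicator_of_mem hx _
  · intro b' _ hb'
    exact indicator_of_notMem
      (fun hx' => Set.disjoint_left.1 (hP.pairwise_disjoint_omega hD hb') hx' hx) _
  · exact fun h => absurd (Finset.mem_univ _) h

lemma lintegral_comp_reconD (hP : P.IsLumping D) (hd : d = 2 ∨ d = 3) (hD : D.IsMesh Ω)
    (hΩ : Bornology.IsBounded Ω) (f : ℝ → ℝ≥0∞) (v : W M V) :
    ∫⁻ x in Ω, f (P.reconD D v x) = ∑ b, ENNReal.ofReal (P.mass D b) * f (v b) := by
  rw [← setLIntegral_congr (hP.iUnion_omega_ae_eq hd hD hΩ),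
    lintegral_iUnion (fun b => (hP.isOpen_omega b).measurableSet)
      (hP.pairwise_disjoint_omega hD), tsum_fintype]
  refine Finset.sum_congr rfl fun b _ => ?_
  rw [setLIntegral_congr_fun (g := fun _ => f (v b)) (hP.isOpen_omega b).measurableSet
    fun x hx => by simp only [hP.reconD_of_mem_omega hD v hx], setLIntegral_const,
    hP.volume_omega hD hΩ, mul_comm]

lemma integral_comp_reconD (hP : P.IsLumping D) (hd : d = 2 ∨ d = 3) (hD : D.IsMesh Ω)
    (hΩ : Bornology.IsBounded Ω) (f : ℝ → ℝ → ℝ) (v v' : W M V) :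
    ∫ x in Ω, f (P.reconD D v x) (P.reconD D v' x) = ∑ b, P.mass D b * f (v b) (v' b) := by
  have hcongr : ∀ b, EqOn (fun x => f (P.reconD D v x) (P.reconD D v' x))
      (fun _ => f (v b) (v' b)) (P.omega D b) := fun b x hx => by
    simp only [hP.reconD_of_mem_omega hD v hx, hP.reconD_of_mem_omega hD v' hx]
  have hmeas : ∀ b, MeasurableSet (P.omega D b) := fun b => (hP.isOpen_omega b).measurableSet
  rw [← setIntegral_congr_set (hP.iUnion_omega_ae_eq hd hD hΩ),
    integral_iUnion_fintype hmeas (hP.pairwise_disjoint_omega hD) fun b =>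
      (integrableOn_const (hP.volume_omega_ne_top hD hΩ b)).congr_fun (hcongr b).symm (hmeas b)]
  refine Finset.sum_congr rfl fun b _ => ?_
  rw [setIntegral_congr_fun (hmeas b) (hcongr b), setIntegral_const,
    hP.volume_real_omega hD hΩ, smul_eq_mul]

lemma entropyD_eq_sum (hP : P.IsLumping D) (hd : d = 2 ∨ d = 3) (hD : D.IsMesh Ω)
    (hΩ : Bornology.IsBounded Ω) (hm : ∀ b, 0 < P.mass D b) {η p : ℝ → ℝ} (hp : IsPressure η p)
    (Vext : Space d → ℝ) {v : W M V} (hv : ∀ b, v b ∈ closure (Ip p)) :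
    P.entropyD D Ω p Vext v = ((∑ b, P.mass D b * (entropyReal p (v b)
      + v b * D.potential Vext b) : ℝ) : EReal) := by
  have hnn : ∀ b ∈ Finset.univ, 0 ≤ P.mass D b * entropyReal p (v b) := fun b _ =>
    mul_nonneg (hm b).le (hp.entropyReal_nonneg (hv b))
  have hGam : ∑ b, ENNReal.ofReal (P.mass D b) * Gam p (v b)
      = ENNReal.ofReal (∑ b, P.mass D b * entropyReal p (v b)) := by
    rw [ENNReal.ofReal_sum_of_nonneg hnn]
    exact Finset.sum_congr rfl fun b _ => by
      rw [Gam, if_pos (hv b), ENNReal.ofReal_mul (hm b).le]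
  rw [entropyD, hP.lintegral_comp_reconD hd hD hΩ,
    hP.integral_comp_reconD hd hD hΩ (fun a b => a * b), hGam, EReal.coe_ennreal_ofReal,
    max_eq_left (Finset.sum_nonneg hnn), ← EReal.coe_add, ← Finset.sum_add_distrib]
  simp_rw [← mul_add]

lemma mem_closure_Ip_of_mem_finiteEntropy (hP : P.IsLumping D) (hd : d = 2 ∨ d = 3)
    (hD : D.IsMesh Ω) (hΩ : Bornology.IsBounded Ω) (hm : ∀ b, 0 < P.mass D b) {p : ℝ → ℝ}
    {Vext : Space d → ℝ} {v : W M V} (hv : v ∈ P.FiniteEntropy D Ω p Vext) (b : M ⊕ V) :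
    v b ∈ closure (Ip p) := by
  by_contra hb
  have htop : ∑ b, ENNReal.ofReal (P.mass D b) * Gam p (v b) = ⊤ :=
    ENNReal.sum_eq_top.2 ⟨b, Finset.mem_univ _, by
      rw [Gam, if_neg hb, ENNReal.mul_top (by simpa using hm b)]⟩
  have hv : P.entropyD D Ω p Vext v < ⊤ := hv
  rw [entropyD, hP.lintegral_comp_reconD hd hD hΩ, htop, EReal.coe_ennreal_top,
    EReal.top_add_coe] at hv
  exact lt_irrefl _ hv

lemma exists_pos_of_integral_reconD_pos (hP : P.IsLumping D) (hd : d = 2 ∨ d = 3)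
    (hD : D.IsMesh Ω) (hΩ : Bornology.IsBounded Ω) (hm : ∀ b, 0 ≤ P.mass D b) {v : W M V}
    (hv : 0 < ∫ x in Ω, P.reconD D v x) : ∃ b, 0 < v b := by
  rw [hP.integral_comp_reconD hd hD hΩ (fun a _ => a) v v] at hv
  by_contra! hneg
  exact hv.not_ge (Finset.sum_nonpos fun b _ => mul_nonpos_of_nonneg_of_nonpos (hm b) (hneg b))

end IsLumping

end Lumping

/-! ### The energy inequality -/

namespace MeshData

variable {d : ℕ} {M F V : Type*} [DecidableEq M] [DecidableEq F] [DecidableEq V]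
  {D : MeshData d M F V} {Ω : Set (Space d)} {L : Space d → Space d →L[ℝ] Space d}
  {η p : ℝ → ℝ} {Vext : Space d → ℝ} {κ : M}

/-- The dissipation `δ_κ h · B_κ(u) δ_κ h` of a cell, for a potential `h` that need not be the
hydrostatic pressure of `u`. -/
noncomputable def dissipation (D : MeshData d M F V) (L : Space d → Space d →L[ℝ] Space d)
    (η : ℝ → ℝ) (u h : W M V) (κ : M) : ℝ :=
  D.del κ h ⬝ᵥ (D.matB L η κ u *ᵥ D.del κ h)

lemma dissipation_eq_dotProduct_matA_mulVec (u h : W M V) :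
    D.dissipation L η u h κ
      = (fun s => √(etaAvg η u κ s.1) * D.del κ h s) ⬝ᵥ
        (D.matA L κ *ᵥ fun s => √(etaAvg η u κ s.1) * D.del κ h s) := by
  simp only [dissipation, matB, matM, dotProduct, Matrix.mulVec, Matrix.mul_diagonal,
    Matrix.diagonal_mul, Finset.mul_sum]
  exact Finset.sum_congr rfl fun s _ => Finset.sum_congr rfl fun s' _ => by ring

lemma sum_fluxCV_mul_del_hydro (u : W M V) :
    ∑ s, D.fluxCV L η p Vext u κ s * D.del κ (D.hydro p Vext u) s
      = D.dissipation L η u (D.hydro p Vext u) κ := by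
  simp only [dissipation, matB, matM, dotProduct, Matrix.mulVec, Matrix.mul_diagonal,
    Matrix.diagonal_mul, fluxCV, Finset.mul_sum, Finset.sum_mul, del]
  exact Finset.sum_congr rfl fun s _ => Finset.sum_congr rfl fun s' _ => by ring

namespace IsMesh

variable [Finite M] [Finite F] [Finite V]

lemma dissipation_nonneg (hd : d = 2 ∨ d = 3) (hD : D.IsMesh Ω) (hΩ : Bornology.IsBounded Ω)
    (hL : IsPermeability Ω L) (u h : W M V) : 0 ≤ D.dissipation L η u h κ := by
  rw [dissipation_eq_dotProduct_matA_mulVec]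
  exact hD.dotProduct_matA_mulVec_nonneg hd hΩ hL _

lemma exists_pos_mul_sq_le_dissipation (hd : d = 2 ∨ d = 3) (hD : D.IsMesh Ω)
    (hΩ : Bornology.IsBounded Ω) (hL : IsPermeability Ω L) (hη : ∀ u, 0 ≤ η u) (κ : M) :
    ∃ c > 0, ∀ (u h : W M V), ∀ s ∈ D.cellVerts κ,
      c * ((η (u (Sum.inl κ)) + η (u (Sum.inr s))) * (h (Sum.inl κ) - h (Sum.inr s)) ^ 2)
        ≤ D.dissipation L η u h κ := by
  obtain ⟨c, hc, hle⟩ := exists_pos_forall_mul_sq_le_dotProduct_mulVec (D.matA L κ)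
    fun w hw => hD.dotProduct_matA_mulVec_pos hd hΩ hL hw
  refine ⟨c / 2, half_pos hc, fun u h s hs => ?_⟩
  have hs := hle (fun s => √(etaAvg η u κ s.1) * D.del κ h s) ⟨s, hs⟩
  rw [← dissipation_eq_dotProduct_matA_mulVec, mul_pow,
    Real.sq_sqrt (by exact div_nonneg (add_nonneg (hη _) (hη _)) zero_le_two)] at hs
  refine le_of_eq_of_le ?_ hs
  simp only [etaAvg, del]
  ring

end IsMesh

end MeshData

namespace Lumping

variable {d : ℕ} {M F V : Type*} [Fintype M] [DecidableEq M] [DecidableEq F] [DecidableEq V]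
  {D : MeshData d M F V} {P : Lumping d M V} {L : Space d → Space d →L[ℝ] Space d}
  {η p : ℝ → ℝ} {Vext : Space d → ℝ} {dt : ℝ} {uOld u : W M V}

/-- The left-hand sides of the equations of the scheme, as one vector of `W_D`. -/
noncomputable def residual (P : Lumping d M V) (D : MeshData d M F V)
    (L : Space d → Space d →L[ℝ] Space d) (η p : ℝ → ℝ) (Vext : Space d → ℝ) (dt : ℝ)
    (uOld u : W M V) : W M V :=
  Sum.elim
    (fun κ => P.mass D (Sum.inl κ) * ((u (Sum.inl κ) - uOld (Sum.inl κ)) / dt)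
      + ∑ s : {s // s ∈ D.cellVerts κ}, D.fluxCV L η p Vext u κ s)
    (fun s => P.mass D (Sum.inr s) * ((u (Sum.inr s) - uOld (Sum.inr s)) / dt)
      + ∑ κ : {κ // s ∈ D.cellVerts κ}, D.fluxVC L η p Vext u κ.1 ⟨s, κ.2⟩)

lemma solvesScheme_iff_residual_eq_zero :
    P.SolvesScheme D L η p Vext dt uOld u ↔ P.residual D L η p Vext dt uOld u = 0 := by
  rw [funext_iff, Sum.forall]
  rfl

variable [Fintype V]

lemma sum_residual_mul (φ : W M V) :
    ∑ b, P.residual D L η p Vext dt uOld u b * φ b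
      = ∑ b, P.mass D b * ((u b - uOld b) / dt) * φ b
        + ∑ κ, ∑ s, D.fluxCV L η p Vext u κ s * D.del κ φ s := by
  have hswap : ∑ s : V, ∑ κ : {κ // s ∈ D.cellVerts κ},
      D.fluxCV L η p Vext u κ.1 ⟨s, κ.2⟩ * φ (Sum.inr s)
        = ∑ κ : M, ∑ s : {s // s ∈ D.cellVerts κ},
          D.fluxCV L η p Vext u κ s * φ (Sum.inr s.1) := by
    rw [Finset.sum_sigma', Finset.sum_sigma']
    exact Finset.sum_bij' (fun x _ => ⟨x.2.1, x.1, x.2.2⟩) (fun x _ => ⟨x.2.1, x.1, x.2.2⟩)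
      (by simp) (by simp) (by simp) (by simp) (by simp)
  simp only [Fintype.sum_sum_type, residual, Sum.elim_inl, Sum.elim_inr, add_mul,
    Finset.sum_add_distrib, Finset.sum_mul, MeshData.fluxVC, neg_mul, Finset.sum_neg_distrib,
    hswap, MeshData.del, mul_sub, Finset.sum_sub_distrib]
  ring

namespace SolvesScheme

lemma sum_mass_mul_sub_mul (hdt : dt ≠ 0) (h : P.SolvesScheme D L η p Vext dt uOld u)
    (φ : W M V) :
    ∑ b, P.mass D b * (u b - uOld b) * φ b
      + dt * ∑ κ, ∑ s, D.fluxCV L η p Vext u κ s * D.del κ φ s = 0 := by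
  have hmass : ∑ b, P.mass D b * (u b - uOld b) * φ b
      = dt * ∑ b, P.mass D b * ((u b - uOld b) / dt) * φ b := by
    rw [Finset.mul_sum]
    exact Finset.sum_congr rfl fun b _ => by field_simp
  rw [hmass, ← mul_add, ← sum_residual_mul, solvesScheme_iff_residual_eq_zero.1 h]
  simp

lemma sum_mass_mul_sub_eq_zero (hdt : dt ≠ 0) (h : P.SolvesScheme D L η p Vext dt uOld u) :
    ∑ b, P.mass D b * (u b - uOld b) = 0 := by
  simpa [MeshData.del] using h.sum_mass_mul_sub_mul hdt 1

lemma sum_mass_mul_sub_mul_hydro (hdt : dt ≠ 0) (h : P.SolvesScheme D L η p Vext dt uOld u) :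
    ∑ b, P.mass D b * (u b - uOld b) * D.hydro p Vext u b
      + dt * ∑ κ, D.dissipation L η u (D.hydro p Vext u) κ = 0 := by
  simpa only [MeshData.sum_fluxCV_mul_del_hydro] using
    h.sum_mass_mul_sub_mul hdt (D.hydro p Vext u)

lemma entropy_add_dissipation_le (hp : IsPressure η p) (hm : ∀ b, 0 ≤ P.mass D b) (hdt : dt ≠ 0)
    (hOld : ∀ b, uOld b ∈ closure (Ip p)) (hu : u ∈ Admissible M V p)
    (h : P.SolvesScheme D L η p Vext dt uOld u) :
    ∑ b, P.mass D b * (entropyReal p (u b) + u b * D.potential Vext b)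
      + dt * ∑ κ, D.dissipation L η u (D.hydro p Vext u) κ
      ≤ ∑ b, P.mass D b * (entropyReal p (uOld b) + uOld b * D.potential Vext b) := by
  have hconvex : ∑ b, P.mass D b * (entropyReal p (u b) + u b * D.potential Vext b)
      - ∑ b, P.mass D b * (entropyReal p (uOld b) + uOld b * D.potential Vext b)
      ≤ ∑ b, P.mass D b * (u b - uOld b) * D.hydro p Vext u b
        - p 1 * ∑ b, P.mass D b * (u b - uOld b) := by
    rw [Finset.mul_sum, ← Finset.sum_sub_distrib, ← Finset.sum_sub_distrib]
    refine Finset.sum_le_sum fun b _ => ?_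
    have := mul_le_mul_of_nonneg_left (hp.entropyReal_sub_le (hu b) (hOld b)) (hm b)
    simp only [MeshData.hydro]
    linarith
  rw [h.sum_mass_mul_sub_eq_zero hdt] at hconvex
  linarith [h.sum_mass_mul_sub_mul_hydro hdt]

end SolvesScheme

end Lumping

/-! ### Existence of a solution -/

lemma bddAbove_image_of_bddAbove_image_sum {ι X : Type*} [Fintype ι] {S : Set X} {f : ι → X → ℝ}
    (hlow : ∀ i, BddBelow (f i '' S)) (hsum : BddAbove ((fun x => ∑ i, f i x) '' S)) (i : ι) :
    BddAbove (f i '' S) := by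
  classical
  choose c hc using hlow
  obtain ⟨C, hC⟩ := hsum
  refine ⟨C - ∑ j ∈ Finset.univ.erase i, c j, forall_mem_image.2 fun x hx => ?_⟩
  have hle : ∑ j ∈ Finset.univ.erase i, c j ≤ ∑ j ∈ Finset.univ.erase i, f j x :=
    Finset.sum_le_sum fun j _ => hc j (mem_image_of_mem _ hx)
  have hCx : ∑ j, f j x ≤ C := hC (mem_image_of_mem _ hx)
  linarith [Finset.add_sum_erase Finset.univ (f · x) (Finset.mem_univ i)]

lemma IsMobility.nonneg {η : ℝ → ℝ} (hη : IsMobility η) (u : ℝ) : 0 ≤ η u := by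
  rcases eq_or_ne u 0 with rfl | hu
  · exact hη.zero.ge
  · exact (hη.pos u hu).le

namespace MeshData

variable {d : ℕ} {M F V : Type*} {D : MeshData d M F V} {η p : ℝ → ℝ} {Vext : Space d → ℝ}

/-- The admissible state `u` whose hydrostatic pressure `h(u)` is `z`. The hydrostatic pressure
ranges over the whole space `W_D`, which is why it is taken as the unknown of the scheme. -/
noncomputable def stateOf (D : MeshData d M F V) (p : ℝ → ℝ) (Vext : Space d → ℝ) (z : W M V) :
    W M V :=
  fun b => pressureInv p (z b - D.potential Vext b)

lemma stateOf_mem_admissible (hp : IsPressure η p) (z : W M V) :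
    D.stateOf p Vext z ∈ Admissible M V p := fun _ => hp.pressureInv_mem _

lemma hydro_stateOf (hp : IsPressure η p) (z : W M V) :
    D.hydro p Vext (D.stateOf p Vext z) = z := by
  funext b
  simp [hydro, stateOf, hp.apply_pressureInv]

lemma continuous_stateOf (hp : IsPressure η p) : Continuous (D.stateOf p Vext) :=
  continuous_pi fun b =>
    hp.continuous_pressureInv.comp ((continuous_apply b).sub continuous_const)

variable {S : Set (W M V)} {a b : M ⊕ V}

lemma bddBelow_image_stateOf_sub_mul (hp : IsPressure η p) {w : ℝ} (hw : w ∈ closure (Ip p)) :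
    BddBelow ((fun z => (D.stateOf p Vext z b - w) * z b) '' S) := by
  refine (hp.bddBelow_range_pressureInv_sub_mul hw (D.potential Vext b)).mono ?_
  rintro _ ⟨z, -, rfl⟩
  exact ⟨z b - D.potential Vext b, by simp [stateOf]⟩

lemma bddAbove_eval_image (hp : IsPressure η p) {w : ℝ}
    (h : BddAbove ((fun z => (D.stateOf p Vext z b - w) * z b) '' S)) :
    BddAbove (Function.eval b '' S) := by
  obtain ⟨C, hC⟩ := h
  obtain ⟨K, hK⟩ := hp.bddAbove_setOf_pressureInv_sub_mul_le w (D.potential Vext b) C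
  refine ⟨K + D.potential Vext b, forall_mem_image.2 fun z hz => sub_le_iff_le_add.1 (hK ?_)⟩
  simpa [stateOf] using hC (mem_image_of_mem _ hz)

lemma bddBelow_eval_image (hp : IsPressure η p) {w : ℝ} (hw : w ∈ Ip p)
    (h : BddAbove ((fun z => (D.stateOf p Vext z b - w) * z b) '' S)) :
    BddBelow (Function.eval b '' S) := by
  obtain ⟨C, hC⟩ := h
  obtain ⟨K, hK⟩ := hp.bddBelow_setOf_pressureInv_sub_mul_le hw (D.potential Vext b) C
  refine ⟨K + D.potential Vext b, forall_mem_image.2 fun z hz => le_sub_iff_add_le.1 (hK ?_)⟩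
  simpa [stateOf] using hC (mem_image_of_mem _ hz)

-- If `p(0) = -∞`, a lower bound on `z a` keeps `u a` away from `0`, hence the mobility as well.
lemma bddBelow_eval_image_of_jump (hs : PressureSingular p) (hη : IsMobility η)
    (hp : IsPressure η p) (ha : BddBelow (Function.eval a '' S))
    (hjump : BddAbove ((fun z =>
      (η (D.stateOf p Vext z a) + η (D.stateOf p Vext z b)) * (z a - z b) ^ 2) '' S)) :
    BddBelow (Function.eval b '' S) := by
  obtain ⟨K, hK⟩ := ha
  obtain ⟨C, hC⟩ := hjump
  have hIp : ∀ y, 0 < pressureInv p y := fun y => hp.pressureInv_mem y hs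
  set ηmin := η (pressureInv p (K - D.potential Vext a))
  have hmin : 0 < ηmin := hη.pos _ (hIp _).ne'
  refine ⟨K - (C / ηmin + 1), forall_mem_image.2 fun z hz => ?_⟩
  have hKz : K ≤ z a := hK (mem_image_of_mem _ hz)
  have hmono : ηmin ≤ η (D.stateOf p Vext z a) + η (D.stateOf p Vext z b) :=
    (hη.mono (hIp _).le (hIp _).le (hp.strictMono_pressureInv.monotone (by linarith))).trans
      (le_add_of_nonneg_right (hη.nonneg _))
  have hsq : (z a - z b) ^ 2 ≤ C / ηmin := by
    rw [le_div_iff₀' hmin]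
    exact (mul_le_mul_of_nonneg_right hmono (sq_nonneg _)).trans (hC (mem_image_of_mem _ hz))
  have : z a - z b ≤ (z a - z b) ^ 2 + 1 := by nlinarith [sq_nonneg (z a - z b - 1)]
  simp only [Function.eval]
  linarith

end MeshData

namespace Lumping

variable {d : ℕ} {M F V : Type*} [Fintype M] [DecidableEq M] [DecidableEq F] [DecidableEq V]
  {D : MeshData d M F V} {P : Lumping d M V} {L : Space d → Space d →L[ℝ] Space d}
  {η p : ℝ → ℝ} {Vext : Space d → ℝ} {dt : ℝ} {uOld : W M V}

lemma continuous_residual_stateOf (hη : Continuous η) (hp : IsPressure η p) :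
    Continuous fun z => P.residual D L η p Vext dt uOld (D.stateOf p Vext z) := by
  have hu : ∀ b, Continuous fun z : W M V => D.stateOf p Vext z b := fun b =>
    (continuous_apply b).comp (MeshData.continuous_stateOf hp)
  have havg : ∀ κ s, Continuous fun z => √(MeshData.etaAvg η (D.stateOf p Vext z) κ s) :=
    fun κ s => (((hη.comp (hu _)).add (hη.comp (hu _))).div_const 2).sqrt
  have hflux : ∀ κ s, Continuous fun z => D.fluxCV L η p Vext (D.stateOf p Vext z) κ s := by
    intro κ s
    simp only [MeshData.fluxCV, MeshData.hydro_stateOf hp]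
    exact (havg κ s).mul (continuous_finsetSum _ fun s' _ =>
      (continuous_const.mul (havg κ s')).mul ((continuous_apply _).sub (continuous_apply _)))
  have hmass : ∀ b, Continuous fun z =>
      P.mass D b * ((D.stateOf p Vext z b - uOld b) / dt) := fun b =>
    continuous_const.mul (((hu b).sub continuous_const).div_const dt)
  refine continuous_pi fun b => ?_
  rcases b with κ | s
  · exact (hmass _).add (continuous_finsetSum _ fun s _ => hflux κ s)
  · exact (hmass _).add (continuous_finsetSum _ fun κ _ => (hflux κ.1 _).neg)

variable [Fintype V]

lemma sum_residual_stateOf_mul (hp : IsPressure η p) (z : W M V) :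
    ∑ b, P.residual D L η p Vext dt uOld (D.stateOf p Vext z) b * z b
      = ∑ b, P.mass D b / dt * ((D.stateOf p Vext z b - uOld b) * z b)
        + ∑ κ, D.dissipation L η (D.stateOf p Vext z) z κ := by
  have hflux : ∀ κ, ∑ s, D.fluxCV L η p Vext (D.stateOf p Vext z) κ s * D.del κ z s
      = D.dissipation L η (D.stateOf p Vext z) z κ := fun κ => by
    have h := MeshData.sum_fluxCV_mul_del_hydro (D := D) (L := L) (η := η) (p := p)
      (Vext := Vext) (κ := κ) (D.stateOf p Vext z)
    rwa [MeshData.hydro_stateOf hp] at h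
  rw [sum_residual_mul, Finset.sum_congr rfl fun κ _ => hflux κ]
  congr 1
  exact Finset.sum_congr rfl fun b _ => by ring

/-- The hydrostatic pressures `z` at which the residual of the scheme does not point strictly
outwards. Once this set is bounded, the residual points outwards on a large sphere and therefore
has a zero inside. -/
def inwardSet (P : Lumping d M V) (D : MeshData d M F V) (L : Space d → Space d →L[ℝ] Space d)
    (η p : ℝ → ℝ) (Vext : Space d → ℝ) (dt : ℝ) (uOld : W M V) : Set (W M V) :=
  {z | ∑ b, P.residual D L η p Vext dt uOld (D.stateOf p Vext z) b * z b ≤ 0}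

lemma exists_admissible_solvesScheme (hη : Continuous η) (hp : IsPressure η p)
    (hS : Bornology.IsBounded (P.inwardSet D L η p Vext dt uOld)) :
    ∃ u ∈ Admissible M V p, P.SolvesScheme D L η p Vext dt uOld u := by
  let G : EuclideanSpace ℝ (M ⊕ V) → EuclideanSpace ℝ (M ⊕ V) := fun z =>
    WithLp.toLp 2 (P.residual D L η p Vext dt uOld (D.stateOf p Vext (WithLp.ofLp z)))
  have hG : Continuous G := (PiLp.continuous_toLp 2 _).comp
    ((continuous_residual_stateOf hη hp).comp (PiLp.continuous_ofLp 2 _))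
  have hinner : ∀ z, inner ℝ (G z) z = ∑ b, P.residual D L η p Vext dt uOld
      (D.stateOf p Vext (WithLp.ofLp z)) b * z b := fun z => by
    rw [PiLp.inner_apply]
    exact Finset.sum_congr rfl fun b _ => mul_comm _ _
  obtain ⟨R, hR, hlt⟩ :=
    ((PiLp.antilipschitzWith_ofLp 2 fun _ : M ⊕ V => ℝ).isBounded_preimage hS).exists_pos_norm_lt
  obtain ⟨z, -, hz⟩ := exists_eq_zero_of_inner_nonneg hR hG.continuousOn fun z hz => by
    by_contra! hneg
    exact (hlt z ((hinner z).symm.trans_le hneg.le)).ne hz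
  exact ⟨D.stateOf p Vext (WithLp.ofLp z), MeshData.stateOf_mem_admissible hp _,
    solvesScheme_iff_residual_eq_zero.2 (congrArg WithLp.ofLp hz)⟩

variable [Finite F] {Ω : Set (Space d)}

lemma bddAbove_terms_inwardSet (hd : d = 2 ∨ d = 3) (hD : D.IsMesh Ω)
    (hΩ : Bornology.IsBounded Ω) (hp : IsPressure η p) (hL : IsPermeability Ω L)
    (hm : ∀ b, 0 < P.mass D b) (hdt : 0 < dt) (hOld : ∀ b, uOld b ∈ closure (Ip p)) :
    (∀ b, BddAbove ((fun z => (D.stateOf p Vext z b - uOld b) * z b) ''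
      P.inwardSet D L η p Vext dt uOld)) ∧
    ∀ κ, BddAbove ((fun z => D.dissipation L η (D.stateOf p Vext z) z κ) ''
      P.inwardSet D L η p Vext dt uOld) := by
  have hμ : ∀ b, 0 < P.mass D b / dt := fun b => div_pos (hm b) hdt
  let term : (M ⊕ V) ⊕ M → W M V → ℝ := Sum.elim
    (fun b z => P.mass D b / dt * ((D.stateOf p Vext z b - uOld b) * z b))
    (fun κ z => D.dissipation L η (D.stateOf p Vext z) z κ)
  have hlow : ∀ i, BddBelow (term i '' P.inwardSet D L η p Vext dt uOld) := by
    rintro (b | κ)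
    · obtain ⟨c, hc⟩ := MeshData.bddBelow_image_stateOf_sub_mul (D := D) (Vext := Vext)
        (S := P.inwardSet D L η p Vext dt uOld) hp (hOld b)
      exact ⟨P.mass D b / dt * c, forall_mem_image.2 fun z hz =>
        mul_le_mul_of_nonneg_left (hc (mem_image_of_mem _ hz)) (hμ b).le⟩
    · exact ⟨0, forall_mem_image.2 fun z _ => hD.dissipation_nonneg hd hΩ hL _ z⟩
  have hsum : BddAbove ((fun z => ∑ i, term i z) '' P.inwardSet D L η p Vext dt uOld) := by
    refine ⟨0, forall_mem_image.2 fun z hz => ?_⟩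
    rw [Fintype.sum_sum_type (α₁ := M ⊕ V)]
    exact (sum_residual_stateOf_mul hp z).symm.trans_le hz
  have hbdd := bddAbove_image_of_bddAbove_image_sum hlow hsum
  refine ⟨fun b => ?_, fun κ => hbdd (Sum.inr κ)⟩
  obtain ⟨C, hC⟩ := hbdd (Sum.inl b)
  exact ⟨C / (P.mass D b / dt), forall_mem_image.2 fun z hz =>
    (le_div_iff₀' (hμ b)).2 (hC (mem_image_of_mem _ hz))⟩

lemma bddAbove_jump_inwardSet (hd : d = 2 ∨ d = 3) (hD : D.IsMesh Ω)
    (hΩ : Bornology.IsBounded Ω) (hη : ∀ u, 0 ≤ η u) (hp : IsPressure η p)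
    (hL : IsPermeability Ω L) (hm : ∀ b, 0 < P.mass D b) (hdt : 0 < dt)
    (hOld : ∀ b, uOld b ∈ closure (Ip p)) {κ : M} {s : V} (hs : s ∈ D.cellVerts κ) :
    BddAbove ((fun z => (η (D.stateOf p Vext z (Sum.inl κ)) + η (D.stateOf p Vext z (Sum.inr s)))
      * (z (Sum.inl κ) - z (Sum.inr s)) ^ 2) '' P.inwardSet D L η p Vext dt uOld) := by
  obtain ⟨c, hc, hle⟩ := hD.exists_pos_mul_sq_le_dissipation hd hΩ hL hη κ
  obtain ⟨C, hC⟩ := (bddAbove_terms_inwardSet hd hD hΩ hp hL hm hdt hOld).2 κ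
  exact ⟨C / c, forall_mem_image.2 fun z hz =>
    (le_div_iff₀' hc).2 ((hle _ z s hs).trans (hC (mem_image_of_mem _ hz)))⟩

lemma bddBelow_eval_inwardSet (hd : d = 2 ∨ d = 3) (hD : D.IsMesh Ω)
    (hΩ : Bornology.IsBounded Ω) (hΩc : IsPreconnected Ω) (hη : IsMobility η)
    (hp : IsPressure η p) (hL : IsPermeability Ω L) (hm : ∀ b, 0 < P.mass D b) (hdt : 0 < dt)
    (hOld : ∀ b, uOld b ∈ closure (Ip p)) (hpos : PressureSingular p → ∃ b, 0 < uOld b) :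
    ∀ b, BddBelow (Function.eval b '' P.inwardSet D L η p Vext dt uOld) := by
  have hinterior : ∀ b, uOld b ∈ Ip p →
      BddBelow (Function.eval b '' P.inwardSet D L η p Vext dt uOld) := fun b hb =>
    MeshData.bddBelow_eval_image hp hb ((bddAbove_terms_inwardSet hd hD hΩ hp hL hm hdt hOld).1 b)
  by_cases hsing : PressureSingular p
  · have hjump := fun κ s (hs : s ∈ D.cellVerts κ) => bddAbove_jump_inwardSet (Vext := Vext)
      hd hD hΩ hη.nonneg hp hL hm hdt hOld hs
    obtain ⟨b₀, hb₀⟩ := hpos hsing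
    refine hD.forall_of_propagates hd hΩ hΩc (fun κ s hs hκ => ?_) (fun κ s hs hsb => ?_)
      ⟨b₀, hinterior b₀ (mem_Ip_of_pos hb₀)⟩
    · exact MeshData.bddBelow_eval_image_of_jump hsing hη hp hκ (hjump κ s hs)
    · refine MeshData.bddBelow_eval_image_of_jump (D := D) (Vext := Vext) hsing hη hp hsb ?_
      convert hjump κ s hs using 3 <;> ring
  · exact fun b => hinterior b fun h => absurd h hsing

lemma isBounded_inwardSet (hd : d = 2 ∨ d = 3) (hD : D.IsMesh Ω)
    (hΩ : Bornology.IsBounded Ω) (hΩc : IsPreconnected Ω) (hη : IsMobility η)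
    (hp : IsPressure η p) (hL : IsPermeability Ω L) (hm : ∀ b, 0 < P.mass D b) (hdt : 0 < dt)
    (hOld : ∀ b, uOld b ∈ closure (Ip p)) (hpos : PressureSingular p → ∃ b, 0 < uOld b) :
    Bornology.IsBounded (P.inwardSet D L η p Vext dt uOld) := by
  refine Bornology.forall_isBounded_image_eval_iff.1 fun b => isBounded_iff_bddBelow_bddAbove.2
    ⟨bddBelow_eval_inwardSet hd hD hΩ hΩc hη hp hL hm hdt hOld hpos b, ?_⟩
  exact MeshData.bddAbove_eval_image hp
    ((bddAbove_terms_inwardSet hd hD hΩ hp hL hm hdt hOld).1 b)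

end Lumping

end VAG

theorem theorem1_general {d : ℕ} (hd : d = 2 ∨ d = 3)
    {M F V : Type*} [Fintype M] [Finite F] [Fintype V]
    [DecidableEq M] [DecidableEq F] [DecidableEq V]
    (Ω : Set (VAG.Space d)) (hΩc : IsPreconnected Ω) (hΩb : Bornology.IsBounded Ω)
    (η p : ℝ → ℝ) (hη : VAG.IsMobility η) (hp : VAG.IsPressure η p)
    (L : VAG.Space d → VAG.Space d →L[ℝ] VAG.Space d) (hL : VAG.IsPermeability Ω L)
    (Vext : VAG.Space d → ℝ) (D : VAG.MeshData d M F V) (hD : D.IsMesh Ω)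
    (P : VAG.Lumping d M V) (hP : P.IsLumping D) (hm : ∀ b, 0 < P.mass D b)
    (dt : ℝ) (hdt : 0 < dt) (uOld : VAG.W M V) (hu : uOld ∈ P.FiniteEntropy D Ω p Vext)
    (hmass : VAG.PressureSingular p → 0 < ∫ x in Ω, P.reconD D uOld x) :
    (∃ u ∈ VAG.Admissible M V p, P.SolvesScheme D L η p Vext dt uOld u) ∧
    ∀ u ∈ VAG.Admissible M V p, P.SolvesScheme D L η p Vext dt uOld u →
      P.entropyD D Ω p Vext u
        + ((dt * ∑ κ, D.del κ (D.hydro p Vext u) ⬝ᵥ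
            (D.matB L η κ u *ᵥ D.del κ (D.hydro p Vext u)) : ℝ) : EReal)
        ≤ P.entropyD D Ω p Vext uOld := by
  have hOld := hP.mem_closure_Ip_of_mem_finiteEntropy hd hD hΩb hm hu
  have hpos : VAG.PressureSingular p → ∃ b, 0 < uOld b := fun hs =>
    hP.exists_pos_of_integral_reconD_pos hd hD hΩb (fun b => (hm b).le) (hmass hs)
  constructor
  · exact VAG.Lumping.exists_admissible_solvesScheme hη.continuous hp
      (VAG.Lumping.isBounded_inwardSet hd hD hΩb hΩc hη hp hL hm hdt hOld hpos)
  · intro u hu h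
    rw [hP.entropyD_eq_sum hd hD hΩb hm hp Vext fun b => subset_closure (hu b),
      hP.entropyD_eq_sum hd hD hΩb hm hp Vext hOld, ← EReal.coe_add, EReal.coe_le_coe_iff]
    exact h.entropy_add_dissipation_le hp (fun b => (hm b).le) hdt.ne' hOld hu

theorem theorem1 {d : ℕ} (hd : d = 2 ∨ d = 3)
    {M F V : Type*} [Fintype M] [Fintype F] [Fintype V]
    [DecidableEq M] [DecidableEq F] [DecidableEq V]
    -- the domain and the data of the continuous problem
    (Ω : Set (VAG.Space d)) (hΩo : IsOpen Ω) (hΩc : IsConnected Ω) (hΩb : Bornology.IsBounded Ω)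
    (η p : ℝ → ℝ) (hη : VAG.IsMobility η) (hp : VAG.IsPressure η p) (hηp : VAG.IsCompatible η p)
    (L : VAG.Space d → VAG.Space d →L[ℝ] VAG.Space d) (hL : VAG.IsPermeability Ω L)
    (Vext : VAG.Space d → ℝ) (hV : ∃ K : ℝ≥0, LipschitzOnWith K Vext (closure Ω))
    -- the mesh, the mass lumping (with positive masses) and the time step
    (D : VAG.MeshData d M F V) (hD : D.IsMesh Ω)
    (P : VAG.Lumping d M V) (hP : P.IsLumping D) (hm : ∀ b, 0 < P.mass D b)
    (dt : ℝ) (hdt : 0 < dt)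
    -- the previous state, of positive total mass if `p(0) = -∞`
    (uOld : VAG.W M V) (hu : uOld ∈ P.FiniteEntropy D Ω p Vext)
    (hmass : VAG.PressureSingular p → 0 < ∫ x in Ω, P.reconD D uOld x) :
    (∃ u ∈ VAG.Admissible M V p, P.SolvesScheme D L η p Vext dt uOld u) ∧
    ∀ u ∈ VAG.Admissible M V p, P.SolvesScheme D L η p Vext dt uOld u →
      P.entropyD D Ω p Vext u
        + ((dt * ∑ κ, D.del κ (D.hydro p Vext u) ⬝ᵥ
            (D.matB L η κ u *ᵥ D.del κ (D.hydro p Vext u)) : ℝ) : EReal)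
        ≤ P.entropyD D Ω p Vext uOld :=
  theorem1_general hd Ω hΩc.isPreconnected hΩb η p hη hp L hL Vext D hD P hP hm dt hdt uOld hu hmass
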